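/- Let $X$ be a locally compact Hausdorff space. All Banach algebras are complex and not necessarily unital. A $C_0(X)$-Banach algebra is a Banach algebra $A$ that is also a Banach $C_0(X)$-module (so $\|\chi a\|\le\|\chi\|_\infty\|a\|$) which is non-degenerate (the linear span of $C_0(X)A$ is dense in $A$), such that the multiplication of $A$ is $C_0(X)$-bilinear. For $x\in X$ its fibre is the quotient Banach algebra $A_x=A/\overline{\mathrm{span}}\,(C_0(X\setminus\{x\})A)$, with quotient map $a\mapsto a_x$; here $C_0(X\setminus\{x\})$ is the ideal of all $\chi\in C_0(X)$ with $\chi(x)=0$. A contractive $C_0(X)$-linear homomorphism $\varphi\colon A\to A'$ of $C_0(X)$-Banach algebras induces homomorphisms $\varphi_x\colon A_x\to A'_x$, $a_x\mapsto\varphi(a)_x$. A contractive homomorphism $\varphi\colon A\to A'$ of Banach algebras is called isoradial if $\rho_{A'}(\varphi(a))=\rho_A(a)$ for all $a\in A$, where $\rho$ denotes the spectral radius (computed in the unitalisation), and full if it is isoradial and has dense range. The Gelfand transform $\hat A$ of $A$ is the $C_0(X)$-Banach algebra, with pointwise operations and supremum norm, of all sections $\xi\in\prod_{x\in X}A_x$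 such that $x\mapsto\|\xi(x)\|$ vanishes at infinity and such that for every $x\in X$ and $\varepsilon>0$ there are $a\in A$ and a neighbourhood $V$ of $x$ with $\|\xi(v)-a_v\|\le\varepsilon$ for all $v\in V$; the canonical homomorphism $\iota_A\colon A\to\hat A$ sends $a$ to $x\mapsto a_x$. $K_*=(K_0,K_1)$ denotes the topological K-theory of Banach algebras: $K_i(A)=\ker(K_i(A^+)\to K_i(\mathbb C))$ for the unitalisation $A^+$, where for unital $R$ the group $K_0(R)$ is the Grothendieck group of equivalence classes of idempotent matrices over $R$, and $K_1(R)=\varinjlim_n GL_n(R)/GL_n(R)_0$, with $GL_n(R)_0$ the connected component of the identity. (1) Assume that $X$ is second countable. Let $A$ and $A'$ be $C_0(X)$-Banach algebras and let $\varphi\colon A\to A'$ be a contractive $C_0(X)$-linear homomorphism such that $\varphi_x\colon A_x\to A'_x$ is isoradial for every $x\in X$. Then $\varphi$ is isoradial. If, moreover, $\varphi_x$ has dense image for every $x\in X$, then $\varphi_*\colon K_*(A)\to K_*(A')$ is an isomorphism. (2) Let $A$ be a $C_0(X)$-Banach algebra. Then the canonical homomorphism $\iota_A\colon A\to\hat A$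 is full, and it induces an isomorphism $K_*(A)\cong K_*(\hat A)$. -/

import Mathlib

open scoped ZeroAtInfty ENNReal Topology

/-! ### `C₀(X)`-Banach algebras -/

/-- A `C₀(X)`-Banach algebra structure on a complex (possibly non-unital) Banach algebra `A`:
a contractive, non-degenerate module structure over the Banach algebra `C₀(X)` for which the
multiplication of `A` is `C₀(X)`-bilinear. -/
class C0BanachAlgebra (X A : Type*) [TopologicalSpace X] [NonUnitalNormedRing A]
    [NormedSpace ℂ A] extends SMul C₀(X, ℂ) A where
  smul_add' (χ : C₀(X, ℂ)) (a b : A) : χ • (a + b) = χ • a + χ • b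
  add_smul' (χ ψ : C₀(X, ℂ)) (a : A) : (χ + ψ) • a = χ • a + ψ • a
  mul_smul' (χ ψ : C₀(X, ℂ)) (a : A) : (χ * ψ) • a = χ • (ψ • a)
  smul_smul_left' (z : ℂ) (χ : C₀(X, ℂ)) (a : A) : (z • χ) • a = z • (χ • a)
  smul_smul_right' (z : ℂ) (χ : C₀(X, ℂ)) (a : A) : χ • (z • a) = z • (χ • a)
  norm_smul_le' (χ : C₀(X, ℂ)) (a : A) : ‖χ • a‖ ≤ ‖χ‖ * ‖a‖
  smul_mul' (χ : C₀(X, ℂ)) (a b : A) : χ • (a * b) = (χ • a) * b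
  mul_smul_comm' (χ : C₀(X, ℂ)) (a b : A) : χ • (a * b) = a * (χ • b)
  nondegenerate' : Dense (Submodule.span ℂ {b : A | ∃ (χ : C₀(X, ℂ)) (a : A), b = χ • a} : Set A)

namespace C0BanachAlgebra

set_option linter.unusedSectionVars false

section Fibre

variable (X A : Type*) [TopologicalSpace X] [NonUnitalNormedRing A] [NormedSpace ℂ A]
  [IsScalarTower ℂ A A] [SMulCommClass ℂ A A] [C0BanachAlgebra X A]

/-- The closed ideal `C₀(X ∖ {x}) A` of `A`, where `C₀(X ∖ {x})` is identified with the functions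
in `C₀(X)` that vanish at `x`. -/
def fibreIdeal (x : X) : Submodule ℂ A :=
  (Submodule.span ℂ {b : A | ∃ (χ : C₀(X, ℂ)) (a : A), χ x = 0 ∧ b = χ • a}).topologicalClosure

instance (x : X) : IsClosed (fibreIdeal X A x : Set A) := Submodule.isClosed_topologicalClosure _

theorem closure_span_le_comap {B C : Type*} [NormedAddCommGroup B] [NormedSpace ℂ B]
    [NormedAddCommGroup C] [NormedSpace ℂ C] (s : Set B) (t : Submodule ℂ C)
    (ht : IsClosed (t : Set C)) (f : B →ₗ[ℂ] C) (hf : Continuous f) (h : ∀ b ∈ s, f b ∈ t) :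
    (Submodule.span ℂ s).topologicalClosure ≤ t.comap f := by
  refine Submodule.topologicalClosure_minimal _ (Submodule.span_le.2 h) ?_
  exact ht.preimage hf

theorem smul_mem_fibreIdeal {x : X} {χ : C₀(X, ℂ)} (h : χ x = 0) (a : A) :
    χ • a ∈ fibreIdeal X A x :=
  Submodule.le_topologicalClosure _ (Submodule.subset_span ⟨χ, a, h, rfl⟩)

theorem mul_mem_fibreIdeal_left {x : X} (a : A) {b : A} (hb : b ∈ fibreIdeal X A x) :
    a * b ∈ fibreIdeal X A x := by
  refine closure_span_le_comap _ (fibreIdeal X A x) inferInstance (LinearMap.mulLeft ℂ a)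
    (continuous_const_mul a) ?_ hb
  rintro _ ⟨χ, c, h, rfl⟩
  rw [LinearMap.mulLeft_apply, ← mul_smul_comm']
  exact smul_mem_fibreIdeal X A h _

theorem mul_mem_fibreIdeal_right {x : X} {a : A} (b : A) (ha : a ∈ fibreIdeal X A x) :
    a * b ∈ fibreIdeal X A x := by
  refine closure_span_le_comap _ (fibreIdeal X A x) inferInstance (LinearMap.mulRight ℂ b)
    (continuous_mul_const b) ?_ ha
  rintro _ ⟨χ, c, h, rfl⟩
  rw [LinearMap.mulRight_apply, ← smul_mul']
  exact smul_mem_fibreIdeal X A h _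

/-- The fibre `A_x = A / C₀(X ∖ {x}) A` with the quotient norm. -/
def Fibre (x : X) : Type _ := A ⧸ fibreIdeal X A x

noncomputable instance (x : X) : NormedAddCommGroup (Fibre X A x) :=
  inferInstanceAs (NormedAddCommGroup (A ⧸ fibreIdeal X A x))

noncomputable instance (x : X) : NormedSpace ℂ (Fibre X A x) :=
  inferInstanceAs (NormedSpace ℂ (A ⧸ fibreIdeal X A x))

instance [CompleteSpace A] (x : X) : CompleteSpace (Fibre X A x) :=
  inferInstanceAs (CompleteSpace (A ⧸ fibreIdeal X A x))

/-- The quotient map `a ↦ a_x`. -/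
def fibreMk (x : X) : A →ₗ[ℂ] Fibre X A x := (fibreIdeal X A x).mkQ

instance (x : X) : Mul (Fibre X A x) where
  mul := Quotient.map₂ (· * ·) (by
    intro a a' h b b' h'
    replace h : a - a' ∈ fibreIdeal X A x := (Submodule.quotientRel_def _).1 h
    replace h' : b - b' ∈ fibreIdeal X A x := (Submodule.quotientRel_def _).1 h'
    refine (Submodule.quotientRel_def _).2 ?_
    have : a * b - a' * b' = (a - a') * b + a' * (b - b') := by noncomm_ring
    rw [this]
    exact add_mem (mul_mem_fibreIdeal_right X A b h) (mul_mem_fibreIdeal_left X A a' h'))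

theorem fibreMk_mul (x : X) (a b : A) : fibreMk X A x (a * b) = fibreMk X A x a * fibreMk X A x b :=
  rfl

theorem fibreMk_surjective (x : X) : Function.Surjective (fibreMk X A x) :=
  (fibreIdeal X A x).mkQ_surjective

theorem norm_fibreMk_le (x : X) (a : A) : ‖fibreMk X A x a‖ ≤ ‖a‖ :=
  Submodule.Quotient.norm_mk_le _ a

noncomputable instance (x : X) : NonUnitalNormedRing (Fibre X A x) where
  __ := (inferInstance : NormedAddCommGroup (Fibre X A x))
  left_distrib := by
    intro p q r
    obtain ⟨a, rfl⟩ := fibreMk_surjective X A x p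
    obtain ⟨b, rfl⟩ := fibreMk_surjective X A x q
    obtain ⟨c, rfl⟩ := fibreMk_surjective X A x r
    simp only [← fibreMk_mul, ← map_add, mul_add]
  right_distrib := by
    intro p q r
    obtain ⟨a, rfl⟩ := fibreMk_surjective X A x p
    obtain ⟨b, rfl⟩ := fibreMk_surjective X A x q
    obtain ⟨c, rfl⟩ := fibreMk_surjective X A x r
    simp only [← fibreMk_mul, ← map_add, add_mul]
  zero_mul := by
    intro p
    obtain ⟨a, rfl⟩ := fibreMk_surjective X A x p
    rw [← map_zero (fibreMk X A x), ← fibreMk_mul, zero_mul]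
  mul_zero := by
    intro p
    obtain ⟨a, rfl⟩ := fibreMk_surjective X A x p
    rw [← map_zero (fibreMk X A x), ← fibreMk_mul, mul_zero]
  mul_assoc := by
    intro p q r
    obtain ⟨a, rfl⟩ := fibreMk_surjective X A x p
    obtain ⟨b, rfl⟩ := fibreMk_surjective X A x q
    obtain ⟨c, rfl⟩ := fibreMk_surjective X A x r
    simp only [← fibreMk_mul, mul_assoc]
  norm_mul_le := by
    intro p q
    have hlim : Filter.Tendsto (fun ε : ℝ => (‖p‖ + ε) * (‖q‖ + ε)) (𝓝[>] 0)
        (𝓝 (‖p‖ * ‖q‖)) := by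
      have : Continuous fun ε : ℝ => (‖p‖ + ε) * (‖q‖ + ε) := by fun_prop
      simpa using (this.tendsto 0).mono_left nhdsWithin_le_nhds
    refine ge_of_tendsto hlim ?_
    filter_upwards [self_mem_nhdsWithin] with ε hε
    obtain ⟨a, rfl, ha⟩ : ∃ a, fibreMk X A x a = p ∧ ‖a‖ < ‖p‖ + ε :=
      Submodule.Quotient.norm_mk_lt p hε
    obtain ⟨b, rfl, hb⟩ : ∃ b, fibreMk X A x b = q ∧ ‖b‖ < ‖q‖ + ε :=
      Submodule.Quotient.norm_mk_lt q hε
    calc ‖fibreMk X A x a * fibreMk X A x b‖ = ‖fibreMk X A x (a * b)‖ := rfl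
      _ ≤ ‖a * b‖ := norm_fibreMk_le X A x _
      _ ≤ ‖a‖ * ‖b‖ := norm_mul_le a b
      _ ≤ _ := mul_le_mul ha.le hb.le (norm_nonneg _) ((norm_nonneg a).trans ha.le)

instance (x : X) : IsScalarTower ℂ (Fibre X A x) (Fibre X A x) where
  smul_assoc z p q := by
    obtain ⟨a, rfl⟩ := fibreMk_surjective X A x p
    obtain ⟨b, rfl⟩ := fibreMk_surjective X A x q
    simp only [smul_eq_mul, ← fibreMk_mul, ← map_smul, smul_mul_assoc]

instance (x : X) : SMulCommClass ℂ (Fibre X A x) (Fibre X A x) where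
  smul_comm z p q := by
    obtain ⟨a, rfl⟩ := fibreMk_surjective X A x p
    obtain ⟨b, rfl⟩ := fibreMk_surjective X A x q
    simp only [smul_eq_mul, ← fibreMk_mul, ← map_smul, mul_smul_comm]

theorem sub_smul_mem_fibreIdeal (x : X) (χ : C₀(X, ℂ)) (a : A) :
    χ • a - χ x • a ∈ fibreIdeal X A x := by
  let f : A →ₗ[ℂ] A :=
    { toFun := fun a => χ • a - χ x • a
      map_add' := fun a b => by rw [smul_add', smul_add]; abel
      map_smul' := fun z a => by
        rw [smul_smul_right', smul_comm (χ x) z a, ← smul_sub]; rfl }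
  have hf : Continuous f := by
    refine AddMonoidHomClass.continuous_of_bound f (‖χ‖ + ‖χ x‖) fun a => ?_
    calc ‖χ • a - χ x • a‖ ≤ ‖χ • a‖ + ‖χ x • a‖ := norm_sub_le _ _
      _ ≤ ‖χ‖ * ‖a‖ + ‖χ x‖ * ‖a‖ := add_le_add (norm_smul_le' χ a) (norm_smul_le _ _)
      _ = _ := by ring
  have h := closure_span_le_comap
    {b : A | ∃ (χ : C₀(X, ℂ)) (a : A), b = χ • a} (fibreIdeal X A x) inferInstance f hf (by
      rintro _ ⟨ψ, b, rfl⟩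
      have : f (ψ • b) = (χ * ψ - χ x • ψ) • b := by
        rw [sub_eq_add_neg, add_smul', mul_smul', ← neg_one_smul ℂ (χ x • ψ), smul_smul_left',
          smul_smul_left', neg_one_smul, ← sub_eq_add_neg]
        rfl
      rw [this]
      exact smul_mem_fibreIdeal X A (by simp) _)
  refine h ?_
  exact nondegenerate' (X := X) a

theorem fibreMk_smul (x : X) (χ : C₀(X, ℂ)) (a : A) :
    fibreMk X A x (χ • a) = χ x • fibreMk X A x a := by
  rw [← map_smul, ← sub_eq_zero, ← map_sub]
  exact (Submodule.Quotient.mk_eq_zero _).2 (sub_smul_mem_fibreIdeal X A x χ a)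

end Fibre

section Gelfand

variable (X A : Type*) [TopologicalSpace X] [NonUnitalNormedRing A] [NormedSpace ℂ A]
  [IsScalarTower ℂ A A] [SMulCommClass ℂ A A] [C0BanachAlgebra X A]

/-- Continuous sections of the upper semi-continuous field `(A_x)_{x ∈ X}`: those which are locally
uniform limits of sections of the form `x ↦ a_x` with `a ∈ A`. -/
def IsContSection (ξ : ∀ x : X, Fibre X A x) : Prop :=
  ∀ x : X, ∀ ε > 0, ∃ a : A, ∀ᶠ v in 𝓝 x, ‖ξ v - fibreMk X A v a‖ ≤ ε

/-- Sections whose norm vanishes at infinity. -/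
def VanishesAtInfty (ξ : ∀ x : X, Fibre X A x) : Prop :=
  Filter.Tendsto (fun x => ‖ξ x‖) (Filter.cocompact X) (𝓝 0)

variable {X A} in
theorem IsContSection.eventually_bounded {ξ : ∀ x : X, Fibre X A x} (h : IsContSection X A ξ)
    (x : X) : ∃ C > 0, ∀ᶠ v in 𝓝 x, ‖ξ v‖ ≤ C := by
  obtain ⟨a, ha⟩ := h x 1 one_pos
  refine ⟨1 + ‖a‖, by positivity, ha.mono fun v hv => ?_⟩
  calc ‖ξ v‖ = ‖(ξ v - fibreMk X A v a) + fibreMk X A v a‖ := by rw [sub_add_cancel]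
    _ ≤ _ := (norm_add_le _ _).trans (add_le_add hv (norm_fibreMk_le X A v a))

/-- Continuous sections that vanish at infinity are automatically bounded, so that nothing is lost
by working inside the `ℓ^∞`-product of the fibres below. -/
theorem bounded_of_section {ξ : ∀ x : X, Fibre X A x} (h : IsContSection X A ξ)
    (h0 : VanishesAtInfty X A ξ) : Memℓp ξ ∞ := by
  obtain ⟨K, hK, hK'⟩ := Filter.mem_cocompact.1 (h0.eventually (gt_mem_nhds one_pos))
  choose C hC hC' using fun x => h.eventually_bounded x
  obtain ⟨t, -, ht⟩ := hK.elim_nhds_subcover (fun x => {v | ‖ξ v‖ ≤ C x}) (fun x _ => hC' x)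
  refine memℓp_infty ⟨1 + ∑ x ∈ t, C x, ?_⟩
  rintro _ ⟨v, rfl⟩
  have hs : 0 ≤ ∑ x ∈ t, C x := Finset.sum_nonneg fun x _ => (hC x).le
  by_cases hv : v ∈ K
  · obtain ⟨x, hx, hvx⟩ := Set.mem_iUnion₂.1 (ht hv)
    have h1 : C x ≤ ∑ x ∈ t, C x := Finset.single_le_sum (fun x _ => (hC x).le) hx
    have h2 : ‖ξ v‖ ≤ C x := hvx
    change ‖ξ v‖ ≤ _
    linarith
  · have h2 : ‖ξ v‖ < 1 := hK' hv
    change ‖ξ v‖ ≤ _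
    linarith

/-- `Γ₀(X, (A_x)_x)` as a subalgebra of the `ℓ^∞`-product of the fibres: continuous sections
vanishing at infinity, with pointwise operations and the supremum norm. -/
def gelfandSubalgebra : NonUnitalSubalgebra ℂ (lp (fun x : X => Fibre X A x) ∞) where
  carrier := {ξ | IsContSection X A ξ ∧ VanishesAtInfty X A ξ}
  zero_mem' := by
    refine ⟨fun x ε hε => ⟨0, .of_forall fun v => ?_⟩, ?_⟩
    · simpa using hε.le
    · simpa [VanishesAtInfty] using tendsto_const_nhds
  add_mem' := by
    rintro ξ η ⟨hξ, hξ0⟩ ⟨hη, hη0⟩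
    refine ⟨fun x ε hε => ?_, ?_⟩
    · obtain ⟨a, ha⟩ := hξ x (ε / 2) (by positivity)
      obtain ⟨b, hb⟩ := hη x (ε / 2) (by positivity)
      refine ⟨a + b, ?_⟩
      filter_upwards [ha, hb] with v hav hbv
      rw [lp.coeFn_add, Pi.add_apply, map_add, add_sub_add_comm]
      exact (norm_add_le _ _).trans (by linarith)
    · refine squeeze_zero (fun _ => norm_nonneg _) (fun v => norm_add_le _ _) ?_
      simpa using hξ0.add hη0
  mul_mem' := by
    rintro ξ η ⟨hξ, hξ0⟩ ⟨hη, hη0⟩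
    refine ⟨fun x ε hε => ?_, ?_⟩
    · obtain ⟨C, hC, hC'⟩ := hη.eventually_bounded x
      obtain ⟨a, ha⟩ := hξ x (ε / 2 / C) (by positivity)
      obtain ⟨b, hb⟩ := hη x (ε / 2 / (‖a‖ + 1)) (by positivity)
      refine ⟨a * b, ?_⟩
      filter_upwards [ha, hb, hC'] with v hav hbv hCv
      rw [lp.infty_coeFn_mul, Pi.mul_apply, fibreMk_mul]
      have e : ξ v * η v - fibreMk X A v a * fibreMk X A v b =
          (ξ v - fibreMk X A v a) * η v + fibreMk X A v a * (η v - fibreMk X A v b) := by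
        noncomm_ring
      rw [e]
      have h1 : ‖(ξ v - fibreMk X A v a) * η v‖ ≤ ε / 2 / C * C :=
        norm_mul_le_of_le hav hCv
      have h2 : ‖fibreMk X A v a * (η v - fibreMk X A v b)‖ ≤ (‖a‖ + 1) * (ε / 2 / (‖a‖ + 1)) :=
        norm_mul_le_of_le ((norm_fibreMk_le X A v a).trans (by linarith)) hbv
      rw [div_mul_cancel₀ _ hC.ne'] at h1
      rw [mul_div_cancel₀ _ (by positivity)] at h2
      exact (norm_add_le _ _).trans (by linarith)
    · refine squeeze_zero (fun _ => norm_nonneg _) (fun v => norm_mul_le _ _) ?_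
      simpa using hξ0.mul hη0
  smul_mem' := by
    rintro z ξ ⟨hξ, hξ0⟩
    refine ⟨fun x ε hε => ?_, ?_⟩
    · obtain ⟨a, ha⟩ := hξ x (ε / (‖z‖ + 1)) (by positivity)
      refine ⟨z • a, ?_⟩
      filter_upwards [ha] with v hav
      rw [lp.coeFn_smul, Pi.smul_apply, map_smul, ← smul_sub, norm_smul]
      calc ‖z‖ * ‖ξ v - fibreMk X A v a‖ ≤ (‖z‖ + 1) * (ε / (‖z‖ + 1)) := by
            gcongr
            linarith
        _ = ε := mul_div_cancel₀ _ (by positivity)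
    · have := hξ0.const_mul ‖z‖
      rw [mul_zero] at this
      refine this.congr fun v => ?_
      rw [lp.coeFn_smul, Pi.smul_apply, norm_smul]

/-- The Gelfand transform `Â = Γ₀(X, (A_x)_x)` of `A`. -/
def Gelfand : Type _ := gelfandSubalgebra X A

noncomputable instance : NonUnitalNormedRing (Gelfand X A) :=
  inferInstanceAs (NonUnitalNormedRing (gelfandSubalgebra X A))

noncomputable instance : NormedSpace ℂ (Gelfand X A) :=
  inferInstanceAs (NormedSpace ℂ (gelfandSubalgebra X A).toSubmodule)

instance : IsScalarTower ℂ (Gelfand X A) (Gelfand X A) :=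
  inferInstanceAs (IsScalarTower ℂ (gelfandSubalgebra X A) (gelfandSubalgebra X A))

instance : SMulCommClass ℂ (Gelfand X A) (Gelfand X A) :=
  inferInstanceAs (SMulCommClass ℂ (gelfandSubalgebra X A) (gelfandSubalgebra X A))

variable {X A} in
theorem norm_section_le (ξ : lp (fun x : X => Fibre X A x) ∞) (x : X) : ‖ξ x‖ ≤ ‖ξ‖ :=
  lp.norm_apply_le_norm ENNReal.top_ne_zero ξ x

theorem isClosed_gelfandSubalgebra :
    IsClosed (gelfandSubalgebra X A : Set (lp (fun x : X => Fibre X A x) ∞)) := by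
  refine isClosed_of_closure_subset fun ξ hξ => ⟨fun x ε hε => ?_, ?_⟩
  · obtain ⟨η, hη, hd⟩ := Metric.mem_closure_iff.1 hξ (ε / 2) (by positivity)
    obtain ⟨a, ha⟩ := hη.1 x (ε / 2) (by positivity)
    refine ⟨a, ha.mono fun v hv => ?_⟩
    have h1 : ‖ξ v - η v‖ ≤ ‖ξ - η‖ := norm_section_le (ξ - η) v
    rw [dist_eq_norm] at hd
    calc ‖ξ v - fibreMk X A v a‖ = ‖(ξ v - η v) + (η v - fibreMk X A v a)‖ := by
          rw [sub_add_sub_cancel]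
      _ ≤ ε := (norm_add_le _ _).trans (by linarith)
  · refine Metric.tendsto_nhds.2 fun ε hε => ?_
    obtain ⟨η, hη, hd⟩ := Metric.mem_closure_iff.1 hξ (ε / 2) (by positivity)
    have h0 := Metric.tendsto_nhds.1 hη.2 (ε / 2) (by positivity)
    filter_upwards [h0] with v hv
    have h1 : ‖ξ v - η v‖ ≤ ‖ξ - η‖ := norm_section_le (ξ - η) v
    rw [dist_eq_norm] at hd
    rw [dist_zero_right, norm_norm] at hv ⊢
    calc ‖ξ v‖ = ‖(ξ v - η v) + η v‖ := by rw [sub_add_cancel]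
      _ < ε := (norm_add_le _ _).trans_lt (by linarith)

instance [CompleteSpace A] : CompleteSpace (Gelfand X A) :=
  (isClosed_gelfandSubalgebra X A).completeSpace_coe

variable {X A} in
theorem smul_section_mem (χ : C₀(X, ℂ)) {ξ : ∀ x : X, Fibre X A x} (h : IsContSection X A ξ)
    (h0 : VanishesAtInfty X A ξ) :
    IsContSection X A (fun x => χ x • ξ x) ∧ VanishesAtInfty X A (fun x => χ x • ξ x) := by
  refine ⟨fun x ε hε => ?_, ?_⟩
  · obtain ⟨C, hC, hC'⟩ := h.eventually_bounded x
    obtain ⟨a, ha⟩ := h x (ε / 2 / (‖χ x‖ + 1)) (by positivity)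
    refine ⟨χ x • a, ?_⟩
    have hχ : ∀ᶠ v in 𝓝 x, dist (χ v) (χ x) < ε / 2 / C :=
      Metric.tendsto_nhds.1 (map_continuous χ).continuousAt _ (by positivity)
    filter_upwards [hC', ha, hχ] with v h1 h2 h3
    have e : χ v • ξ v - fibreMk X A v (χ x • a) =
        (χ v - χ x) • ξ v + χ x • (ξ v - fibreMk X A v a) := by
      rw [map_smul, sub_smul, smul_sub]; abel
    rw [dist_eq_norm] at h3
    have h4 : ‖(χ v - χ x) • ξ v‖ ≤ ε / 2 / C * C := by
      rw [norm_smul]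
      gcongr
    have h5 : ‖χ x • (ξ v - fibreMk X A v a)‖ ≤ (‖χ x‖ + 1) * (ε / 2 / (‖χ x‖ + 1)) := by
      rw [norm_smul]
      gcongr
      linarith
    rw [div_mul_cancel₀ _ hC.ne'] at h4
    rw [mul_div_cancel₀ _ (by positivity)] at h5
    rw [e]
    exact (norm_add_le _ _).trans (by linarith)
  · have := h0.const_mul ‖χ‖
    rw [mul_zero] at this
    refine squeeze_zero (fun _ => norm_nonneg _) (fun v => ?_) this
    rw [norm_smul]
    gcongr
    exact χ.toBCF.norm_coe_le_norm v

/-- The pointwise action `(χ ξ)(x) = χ(x) ξ(x)` of `C₀(X)` on the Gelfand transform. -/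
noncomputable instance : SMul C₀(X, ℂ) (Gelfand X A) where
  smul χ ξ := ⟨⟨fun x => χ x • ξ.1 x, bounded_of_section X A (smul_section_mem χ ξ.2.1 ξ.2.2).1
    (smul_section_mem χ ξ.2.1 ξ.2.2).2⟩, smul_section_mem χ ξ.2.1 ξ.2.2⟩

variable {X A} in
theorem Gelfand.ext' {ξ η : Gelfand X A} (h : ∀ x, ξ.1 x = η.1 x) : ξ = η :=
  Subtype.ext (lp.ext (funext h))

variable {X A} in
theorem Gelfand.norm_le {ξ : Gelfand X A} {C : ℝ} (hC : 0 ≤ C) (h : ∀ x, ‖ξ.1 x‖ ≤ C) :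
    ‖ξ‖ ≤ C :=
  lp.norm_le_of_forall_le hC h

noncomputable instance [LocallyCompactSpace X] [T2Space X] : C0BanachAlgebra X (Gelfand X A) where
  smul_add' χ ξ η := Gelfand.ext' fun x => smul_add (χ x) (ξ.1 x) (η.1 x)
  add_smul' χ ψ ξ := Gelfand.ext' fun x => add_smul (χ x) (ψ x) (ξ.1 x)
  mul_smul' χ ψ ξ := Gelfand.ext' fun x => mul_smul (χ x) (ψ x) (ξ.1 x)
  smul_smul_left' z χ ξ := Gelfand.ext' fun x => mul_smul z (χ x) (ξ.1 x)
  smul_smul_right' z χ ξ := Gelfand.ext' fun x => smul_comm (χ x) z (ξ.1 x)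
  norm_smul_le' χ ξ := by
    refine Gelfand.norm_le (by positivity) fun x => ?_
    change ‖χ x • ξ.1 x‖ ≤ _
    rw [norm_smul]
    exact mul_le_mul (χ.toBCF.norm_coe_le_norm x) (norm_section_le ξ.1 x) (norm_nonneg _)
      (norm_nonneg _)
  smul_mul' χ ξ η := Gelfand.ext' fun x => (smul_mul_assoc (χ x) (ξ.1 x) (η.1 x)).symm
  mul_smul_comm' χ ξ η := Gelfand.ext' fun x => (mul_smul_comm (χ x) (ξ.1 x) (η.1 x)).symm
  nondegenerate' := by
    refine Metric.dense_iff.2 fun ξ ε hε => ?_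
    obtain ⟨K, hK, hK'⟩ := Filter.mem_cocompact.1
      (ξ.2.2.eventually (gt_mem_nhds (half_pos hε)))
    obtain ⟨f, hf1, -, hfc, hf⟩ := exists_continuous_one_zero_of_isCompact hK
      isClosed_empty (Set.disjoint_empty K)
    let χ : C₀(X, ℂ) :=
      { toFun := fun x => (f x : ℂ)
        continuous_toFun := by fun_prop
        zero_at_infty' := by
          have h0 : HasCompactSupport fun x => (f x : ℂ) := hfc.comp_left Complex.ofReal_zero
          exact h0.is_zero_at_infty }
    refine ⟨χ • ξ, ?_, Submodule.subset_span ⟨χ, ξ, rfl⟩⟩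
    rw [Metric.mem_ball, dist_eq_norm]
    refine lt_of_le_of_lt (Gelfand.norm_le (half_pos hε).le fun x => ?_) (half_lt_self hε)
    change ‖χ x • ξ.1 x - ξ.1 x‖ ≤ ε / 2
    have e : χ x • ξ.1 x - ξ.1 x = ((f x - 1 : ℝ) : ℂ) • ξ.1 x := by
      rw [Complex.ofReal_sub, Complex.ofReal_one, sub_smul, one_smul]
      rfl
    rw [e, norm_smul, Complex.norm_real]
    by_cases hx : x ∈ K
    · rw [hf1 hx]
      simp only [Pi.one_apply, sub_self, norm_zero, zero_mul]
      positivity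
    · have h1 : ‖ξ.1 x‖ < ε / 2 := hK' hx
      have h2 : ‖f x - 1‖ ≤ 1 := by
        rw [Real.norm_eq_abs, abs_le]
        exact ⟨by linarith [(hf x).1], by linarith [(hf x).2]⟩
      calc ‖f x - 1‖ * ‖ξ.1 x‖ ≤ 1 * (ε / 2) := by gcongr
        _ = ε / 2 := one_mul _

end Gelfand

section Hom

/-- A contractive `C₀(X)`-linear homomorphism of `C₀(X)`-Banach algebras. -/
structure ContractiveHom (X A B : Type*) [TopologicalSpace X]
    [NonUnitalNormedRing A] [NormedSpace ℂ A] [C0BanachAlgebra X A]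
    [NonUnitalNormedRing B] [NormedSpace ℂ B] [C0BanachAlgebra X B] extends A →ₙₐ[ℂ] B where
  map_C0_smul' (χ : C₀(X, ℂ)) (a : A) : toFun (χ • a) = χ • toFun a
  norm_map_le' (a : A) : ‖toFun a‖ ≤ ‖a‖

variable {X A B : Type*} [TopologicalSpace X]
  [NonUnitalNormedRing A] [NormedSpace ℂ A] [IsScalarTower ℂ A A] [SMulCommClass ℂ A A]
  [C0BanachAlgebra X A]
  [NonUnitalNormedRing B] [NormedSpace ℂ B] [IsScalarTower ℂ B B] [SMulCommClass ℂ B B]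
  [C0BanachAlgebra X B]

theorem ContractiveHom.continuous (φ : ContractiveHom X A B) :
    Continuous φ.toNonUnitalAlgHom :=
  AddMonoidHomClass.continuous_of_bound φ.toNonUnitalAlgHom 1 fun a => by
    rw [one_mul]
    exact φ.norm_map_le' a

theorem ContractiveHom.map_fibreIdeal (φ : ContractiveHom X A B) (x : X) :
    fibreIdeal X A x ≤ (fibreIdeal X B x).comap (φ.toNonUnitalAlgHom : A →ₗ[ℂ] B) := by
  refine closure_span_le_comap _ (fibreIdeal X B x) inferInstance
    (φ.toNonUnitalAlgHom : A →ₗ[ℂ] B) φ.continuous ?_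
  rintro _ ⟨χ, a, h, rfl⟩
  have : (φ.toNonUnitalAlgHom : A →ₗ[ℂ] B) (χ • a) = χ • φ.toNonUnitalAlgHom a :=
    φ.map_C0_smul' χ a
  rw [this]
  exact smul_mem_fibreIdeal X B h _

/-- The fibre map `φ_x : A_x → B_x`, `a_x ↦ φ(a)_x`. -/
def ContractiveHom.fibreMap (φ : ContractiveHom X A B) (x : X) :
    Fibre X A x →ₙₐ[ℂ] Fibre X B x where
  toFun := Submodule.mapQ _ _ (φ.toNonUnitalAlgHom : A →ₗ[ℂ] B) (φ.map_fibreIdeal x)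
  map_smul' z p := map_smul (Submodule.mapQ _ _ _ (φ.map_fibreIdeal x)) z p
  map_zero' := map_zero (Submodule.mapQ _ _ _ (φ.map_fibreIdeal x))
  map_add' p q := map_add (Submodule.mapQ _ _ _ (φ.map_fibreIdeal x)) p q
  map_mul' p q := by
    obtain ⟨a, rfl⟩ := fibreMk_surjective X A x p
    obtain ⟨b, rfl⟩ := fibreMk_surjective X A x q
    exact congrArg (fibreMk X B x) (map_mul φ.toNonUnitalAlgHom a b)

theorem ContractiveHom.fibreMap_mk (φ : ContractiveHom X A B) (x : X) (a : A) :
    φ.fibreMap x (fibreMk X A x a) = fibreMk X B x (φ.toNonUnitalAlgHom a) := rfl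

variable (X) in
theorem section_mem (a : A) : IsContSection X A (fun x => fibreMk X A x a) ∧
    VanishesAtInfty X A (fun x => fibreMk X A x a) := by
  refine ⟨fun x ε hε => ⟨a, .of_forall fun v => by simpa using hε.le⟩, ?_⟩
  refine Metric.tendsto_nhds.2 fun ε hε => ?_
  obtain ⟨b, hb, hbs⟩ := Metric.dense_iff.1 (nondegenerate' (X := X) (A := A)) a (ε / 2)
    (half_pos hε)
  have key : VanishesAtInfty X A (fun x => fibreMk X A x b) := by
    refine Submodule.span_induction (p := fun b _ =>
      VanishesAtInfty X A (fun x => fibreMk X A x b)) ?_ ?_ ?_ ?_ hbs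
    · rintro _ ⟨χ, c, rfl⟩
      have h0 : Filter.Tendsto (fun x => ‖χ x‖ * ‖c‖) (Filter.cocompact X) (𝓝 0) := by
        simpa using ((zero_at_infty χ).norm).mul_const ‖c‖
      refine squeeze_zero (fun _ => norm_nonneg _) (fun x => ?_) h0
      beta_reduce
      rw [fibreMk_smul, norm_smul]
      gcongr
      exact norm_fibreMk_le X A x c
    · simpa [VanishesAtInfty] using tendsto_const_nhds
    · intro c d _ _ hc hd
      refine squeeze_zero (fun _ => norm_nonneg _) (fun x => ?_) (by simpa using hc.add hd)
      beta_reduce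
      rw [map_add]
      exact norm_add_le _ _
    · intro z c _ hc
      have := hc.const_mul ‖z‖
      rw [mul_zero] at this
      refine this.congr fun x => ?_
      beta_reduce
      rw [map_smul, norm_smul]
  filter_upwards [Metric.tendsto_nhds.1 key (ε / 2) (half_pos hε)] with x hx
  rw [dist_zero_right, norm_norm] at hx ⊢
  rw [Metric.mem_ball, dist_comm, dist_eq_norm] at hb
  calc ‖fibreMk X A x a‖ = ‖fibreMk X A x (a - b) + fibreMk X A x b‖ := by
        rw [map_sub, sub_add_cancel]
    _ ≤ ‖a - b‖ + ‖fibreMk X A x b‖ :=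
        (norm_add_le _ _).trans (by gcongr; exact norm_fibreMk_le X A x _)
    _ < ε := by linarith

variable (X A) in
/-- The canonical homomorphism `ι_A : A → Â`, `a ↦ (x ↦ a_x)`. -/
noncomputable def gelfandHom [LocallyCompactSpace X] [T2Space X] :
    ContractiveHom X A (Gelfand X A) where
  toFun a := ⟨⟨fun x => fibreMk X A x a, bounded_of_section X A (section_mem X a).1
    (section_mem X a).2⟩, section_mem X a⟩
  map_smul' z a := Gelfand.ext' fun x => map_smul (fibreMk X A x) z a
  map_zero' := Gelfand.ext' fun x => map_zero (fibreMk X A x)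
  map_add' a b := Gelfand.ext' fun x => map_add (fibreMk X A x) a b
  map_mul' a b := Gelfand.ext' fun x => fibreMk_mul X A x a b
  map_C0_smul' χ a := Gelfand.ext' fun x => fibreMk_smul X A x χ a
  norm_map_le' a := Gelfand.norm_le (norm_nonneg a) fun x => norm_fibreMk_le X A x a

end Hom

end C0BanachAlgebra

/-! ### Isoradial and full homomorphisms -/

section Radius

variable {A B : Type*} [NonUnitalNormedRing A] [NormedSpace ℂ A] [IsScalarTower ℂ A A]
  [SMulCommClass ℂ A A] [NonUnitalNormedRing B] [NormedSpace ℂ B] [IsScalarTower ℂ B B]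
  [SMulCommClass ℂ B B]

/-- The spectral radius of an element of a (possibly non-unital) Banach algebra, i.e. its spectral
radius in the unitalisation. -/
noncomputable def banachSpectralRadius (a : A) : ℝ≥0∞ :=
  spectralRadius ℂ (a : Unitization ℂ A)

/-- A contractive homomorphism of Banach algebras is isoradial if it preserves spectral radii. -/
structure IsIsoradial (φ : A →ₙₐ[ℂ] B) : Prop where
  norm_map_le (a : A) : ‖φ a‖ ≤ ‖a‖
  radius_map (a : A) : banachSpectralRadius (φ a) = banachSpectralRadius a

/-- A full homomorphism: isoradial with dense range. -/
structure IsFull (φ : A →ₙₐ[ℂ] B) : Prop extends IsIsoradial φ where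
  denseRange : DenseRange φ

end Radius

/-! ### K-theory of complex Banach algebras -/

namespace BanachK

section KZero

/-- Equivalence of idempotent matrices (of possibly different sizes): `e = x y` and `f = y x`.
For idempotents this says that the projective modules they define are isomorphic. -/
def IdemEquiv {R : Type*} [Ring R] {ι κ : Type*} [Fintype ι] [Fintype κ]
    (e : Matrix ι ι R) (f : Matrix κ κ R) : Prop :=
  ∃ (x : Matrix ι κ R) (y : Matrix κ ι R), x * y = e ∧ y * x = f

/-- An idempotent square matrix of some finite size over `R`. -/
structure IdemMatrix (R : Type*) [Ring R] where
  size : ℕ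
  mat : Matrix (Fin size) (Fin size) R
  idem : mat * mat = mat

variable {R S T : Type*} [Ring R] [Ring S] [Ring T]

theorem IdemEquiv.refl {ι : Type*} [Fintype ι] {e : Matrix ι ι R} (he : e * e = e) :
    IdemEquiv e e := ⟨e, e, he, he⟩

theorem IdemEquiv.symm {ι κ : Type*} [Fintype ι] [Fintype κ] {e : Matrix ι ι R}
    {f : Matrix κ κ R} (h : IdemEquiv e f) : IdemEquiv f e := by
  obtain ⟨x, y, h₁, h₂⟩ := h
  exact ⟨y, x, h₂, h₁⟩

theorem IdemEquiv.trans {ι κ τ : Type*} [Fintype ι] [Fintype κ] [Fintype τ] {e : Matrix ι ι R}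
    {f : Matrix κ κ R} {g : Matrix τ τ R} (he : e * e = e) (hg : g * g = g)
    (h : IdemEquiv e f) (h' : IdemEquiv f g) : IdemEquiv e g := by
  obtain ⟨x, y, h₁, h₂⟩ := h
  obtain ⟨z, w, h₃, h₄⟩ := h'
  refine ⟨x * z, w * y, ?_, ?_⟩
  · calc x * z * (w * y) = x * (z * w) * y := by simp only [Matrix.mul_assoc]
      _ = (x * y) * (x * y) := by rw [h₃, ← h₂]; simp only [Matrix.mul_assoc]
      _ = e := by rw [h₁, he]
  · calc w * y * (x * z) = w * (y * x) * z := by simp only [Matrix.mul_assoc]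
      _ = (w * z) * (w * z) := by rw [h₂, ← h₃]; simp only [Matrix.mul_assoc]
      _ = g := by rw [h₄, hg]

theorem IdemEquiv.submatrix {ι κ : Type*} [Fintype ι] [Fintype κ] {e : Matrix ι ι R}
    (he : e * e = e) (σ : κ ≃ ι) : IdemEquiv e (e.submatrix σ σ) := by
  refine ⟨e.submatrix id σ, e.submatrix σ id, ?_, ?_⟩
  · rw [Matrix.submatrix_mul_equiv, he, Matrix.submatrix_id_id]
  · have := Matrix.submatrix_mul_equiv e e σ (Equiv.refl ι) σ
    simp only [Equiv.coe_refl] at this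
    rw [this, he]

theorem IdemEquiv.fromBlocks {ι κ ι' κ' : Type*} [Fintype ι] [Fintype κ] [Fintype ι'] [Fintype κ']
    {e : Matrix ι ι R} {f : Matrix κ κ R} {e' : Matrix ι' ι' R} {f' : Matrix κ' κ' R}
    (h : IdemEquiv e e') (h' : IdemEquiv f f') :
    IdemEquiv (Matrix.fromBlocks e 0 0 f) (Matrix.fromBlocks e' 0 0 f') := by
  obtain ⟨x, y, h₁, h₂⟩ := h
  obtain ⟨z, w, h₃, h₄⟩ := h'
  refine ⟨Matrix.fromBlocks x 0 0 z, Matrix.fromBlocks y 0 0 w, ?_, ?_⟩ <;>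
    simp [Matrix.fromBlocks_multiply, *]

theorem idem_fromBlocks {ι κ : Type*} [Fintype ι] [Fintype κ] {e : Matrix ι ι R}
    {f : Matrix κ κ R} (he : e * e = e) (hf : f * f = f) :
    Matrix.fromBlocks e 0 0 f * Matrix.fromBlocks e 0 0 f = Matrix.fromBlocks e 0 0 f := by
  simp [Matrix.fromBlocks_multiply, he, hf]

theorem idem_submatrix {ι κ : Type*} [Fintype ι] [Fintype κ] {e : Matrix ι ι R}
    (he : e * e = e) (σ : κ ≃ ι) : e.submatrix σ σ * e.submatrix σ σ = e.submatrix σ σ := by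
  rw [Matrix.submatrix_mul_equiv, he]

instance IdemMatrix.setoid (R : Type*) [Ring R] : Setoid (IdemMatrix R) where
  r e f := IdemEquiv e.mat f.mat
  iseqv :=
    { refl := fun e => IdemEquiv.refl e.idem
      symm := IdemEquiv.symm
      trans := fun {e _ g} h h' => IdemEquiv.trans e.idem g.idem h h' }

/-- The block sum `e ⊕ f`. -/
def IdemMatrix.sum (e f : IdemMatrix R) : IdemMatrix R where
  size := e.size + f.size
  mat := (Matrix.fromBlocks e.mat 0 0 f.mat).submatrix finSumFinEquiv.symm finSumFinEquiv.symm
  idem := idem_submatrix (idem_fromBlocks e.idem f.idem) _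

theorem IdemMatrix.sum_equiv (e f : IdemMatrix R) :
    IdemEquiv (e.sum f).mat (Matrix.fromBlocks e.mat 0 0 f.mat) :=
  (IdemEquiv.submatrix (idem_fromBlocks e.idem f.idem) _).symm

/-- The monoid of equivalence classes of idempotent matrices over `R`. -/
def IdemClass (R : Type*) [Ring R] : Type _ := Quotient (IdemMatrix.setoid R)

instance : Add (IdemClass R) where
  add := Quotient.map₂ IdemMatrix.sum (by
    intro e e' h f f' h'
    exact IdemEquiv.trans (e.sum f).idem (e'.sum f').idem
      (IdemEquiv.trans (e.sum f).idem (idem_fromBlocks e'.idem f'.idem)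
        (e.sum_equiv f) (h.fromBlocks h')) (e'.sum_equiv f').symm)

instance : Zero (IdemClass R) where
  zero := Quotient.mk _ ⟨0, 0, by simp⟩

instance : AddCommMonoid (IdemClass R) where
  nsmul := nsmulRec
  add_assoc := by
    rintro ⟨e⟩ ⟨f⟩ ⟨g⟩
    refine Quotient.sound ?_
    change IdemEquiv ((e.sum f).sum g).mat (e.sum (f.sum g)).mat
    have i₁ := idem_fromBlocks (idem_fromBlocks e.idem f.idem) g.idem
    have i₂ := idem_fromBlocks e.idem (idem_fromBlocks f.idem g.idem)
    have h₁ : IdemEquiv ((e.sum f).sum g).mat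
        (Matrix.fromBlocks (Matrix.fromBlocks e.mat 0 0 f.mat) 0 0 g.mat) :=
      ((e.sum f).sum_equiv g).trans ((e.sum f).sum g).idem i₁
        ((e.sum_equiv f).fromBlocks (IdemEquiv.refl g.idem))
    have h₂ : IdemEquiv (e.sum (f.sum g)).mat
        (Matrix.fromBlocks e.mat 0 0 (Matrix.fromBlocks f.mat 0 0 g.mat)) :=
      (e.sum_equiv (f.sum g)).trans (e.sum (f.sum g)).idem i₂
        ((IdemEquiv.refl e.idem).fromBlocks (f.sum_equiv g))
    have h₃ := IdemEquiv.submatrix i₂ (Equiv.sumAssoc _ _ _)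
    have h₄ : (Matrix.fromBlocks e.mat 0 0 (Matrix.fromBlocks f.mat 0 0 g.mat)).submatrix
        (Equiv.sumAssoc _ _ _) (Equiv.sumAssoc _ _ _) =
        Matrix.fromBlocks (Matrix.fromBlocks e.mat 0 0 f.mat) 0 0 g.mat := by
      ext i j
      rcases i with (i | i) | i <;> rcases j with (j | j) | j <;> rfl
    rw [h₄] at h₃
    exact h₁.trans ((e.sum f).sum g).idem (e.sum (f.sum g)).idem
      (h₃.symm.trans i₁ (e.sum (f.sum g)).idem h₂.symm)
  add_comm := by
    rintro ⟨e⟩ ⟨f⟩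
    refine Quotient.sound ?_
    change IdemEquiv (e.sum f).mat (f.sum e).mat
    have h₃ := IdemEquiv.submatrix (idem_fromBlocks e.idem f.idem) (Equiv.sumComm _ _)
    have h₄ : (Matrix.fromBlocks e.mat 0 0 f.mat).submatrix
        (Equiv.sumComm _ _) (Equiv.sumComm _ _) = Matrix.fromBlocks f.mat 0 0 e.mat := by
      ext i j
      rcases i with i | i <;> rcases j with j | j <;> rfl
    rw [h₄] at h₃
    exact (e.sum_equiv f).trans (e.sum f).idem (f.sum e).idem
      (h₃.trans (idem_fromBlocks e.idem f.idem) (f.sum e).idem (f.sum_equiv e).symm)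
  zero_add := by
    rintro ⟨f⟩
    refine Quotient.sound ?_
    let z : IdemMatrix R := ⟨0, 0, by simp⟩
    change IdemEquiv (z.sum f).mat f.mat
    refine (z.sum_equiv f).trans (z.sum f).idem f.idem ?_
    have h₃ := IdemEquiv.submatrix f.idem (Equiv.emptySum (Fin 0) (Fin f.size))
    have h₄ : f.mat.submatrix (Equiv.emptySum (Fin 0) (Fin f.size))
        (Equiv.emptySum (Fin 0) (Fin f.size)) = Matrix.fromBlocks z.mat 0 0 f.mat := by
      ext i j
      rcases i with i | i
      · exact i.elim0
      rcases j with j | j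
      · exact j.elim0
      rfl
    rw [h₄] at h₃
    exact h₃.symm
  add_zero := by
    rintro ⟨f⟩
    refine Quotient.sound ?_
    let z : IdemMatrix R := ⟨0, 0, by simp⟩
    change IdemEquiv (f.sum z).mat f.mat
    refine (f.sum_equiv z).trans (f.sum z).idem f.idem ?_
    have h₃ := IdemEquiv.submatrix f.idem (Equiv.sumEmpty (Fin f.size) (Fin 0))
    have h₄ : f.mat.submatrix (Equiv.sumEmpty (Fin f.size) (Fin 0))
        (Equiv.sumEmpty (Fin f.size) (Fin 0)) = Matrix.fromBlocks f.mat 0 0 z.mat := by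
      ext i j
      rcases i with i | i
      · rcases j with j | j
        · rfl
        · exact j.elim0
      · exact i.elim0
    rw [h₄] at h₃
    exact h₃.symm

/-- Apply a ring homomorphism entrywise to an idempotent matrix. -/
def IdemMatrix.map (f : R →+* S) (e : IdemMatrix R) : IdemMatrix S where
  size := e.size
  mat := e.mat.map f
  idem := by rw [← Matrix.map_mul, e.idem]

/-- The map on classes of idempotents induced by a ring homomorphism. -/
def IdemClass.map (f : R →+* S) : IdemClass R →+ IdemClass S where
  toFun := Quotient.map (IdemMatrix.map f) (by
    rintro e e' ⟨x, y, h₁, h₂⟩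
    have h₃ : x.map f * y.map f = e.mat.map f := by rw [← Matrix.map_mul, h₁]
    have h₄ : y.map f * x.map f = e'.mat.map f := by rw [← Matrix.map_mul, h₂]
    exact ⟨x.map f, y.map f, h₃, h₄⟩)
  map_zero' := by
    refine congrArg (Quotient.mk _) ?_
    simp only [IdemMatrix.map, IdemMatrix.mk.injEq, heq_eq_eq, true_and]
    ext i
    exact i.elim0
  map_add' := by
    rintro ⟨e⟩ ⟨e'⟩
    refine congrArg (Quotient.mk _) ?_
    have h : ((Matrix.fromBlocks e.mat 0 0 e'.mat).submatrix finSumFinEquiv.symm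
        finSumFinEquiv.symm).map f = (Matrix.fromBlocks (e.mat.map f) 0 0
          (e'.mat.map f)).submatrix finSumFinEquiv.symm finSumFinEquiv.symm := by
      rw [← Matrix.submatrix_map, Matrix.fromBlocks_map]
      simp
    simp only [IdemMatrix.map, IdemMatrix.sum, IdemMatrix.mk.injEq, heq_eq_eq, true_and]
    exact h

/-- `K₀` of a unital ring: the Grothendieck group of the classes of idempotent matrices. -/
abbrev K0Unital (R : Type*) [Ring R] : Type _ := Algebra.GrothendieckAddGroup (IdemClass R)

/-- The homomorphism `K₀(R) → K₀(S)` induced by a unital ring homomorphism. -/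
noncomputable def K0Unital.map (f : R →+* S) : K0Unital R →+ K0Unital S :=
  Algebra.GrothendieckAddGroup.lift (Algebra.GrothendieckAddGroup.of.comp (IdemClass.map f))

theorem K0Unital.map_of (f : R →+* S) (x : IdemClass R) :
    K0Unital.map f (Algebra.GrothendieckAddGroup.of x) =
      Algebra.GrothendieckAddGroup.of (IdemClass.map f x) :=
  DFunLike.congr_fun (Algebra.GrothendieckAddGroup.lift.symm_apply_apply
    (Algebra.GrothendieckAddGroup.of.comp (IdemClass.map f))) x

theorem K0Unital.map_map (g : S →+* T) (f : R →+* S) (x : K0Unital R) :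
    K0Unital.map g (K0Unital.map f x) = K0Unital.map (g.comp f) x := by
  have : (K0Unital.map g).comp (K0Unital.map f) = K0Unital.map (g.comp f) := by
    apply Algebra.GrothendieckAddGroup.lift.symm.injective
    ext x
    have key : IdemClass.map g (IdemClass.map f x) = IdemClass.map (g.comp f) x := by
      rcases x with ⟨e⟩
      rfl
    simp only [Algebra.GrothendieckAddGroup.lift_symm_apply, AddMonoidHom.comp_apply,
      K0Unital.map_of, key]
  exact DFunLike.congr_fun this x

end KZero

section KOne

variable (R S T : Type*) [NormedRing R] [NormedRing S] [NormedRing T]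

/-- `GL_n(R)`. -/
abbrev GLn (n : ℕ) : Type _ := (Matrix (Fin n) (Fin n) R)ˣ

instance (n : ℕ) : (Subgroup.connectedComponentOfOne (GLn R n)).Normal where
  conj_mem u hu g := by
    have hc : Continuous fun v : GLn R n => g * v * g⁻¹ := by fun_prop
    have := hc.image_connectedComponent_subset 1 ⟨u, hu, rfl⟩
    rwa [mul_one, mul_inv_cancel] at this

/-- `π₀(GL_n(R)) = GL_n(R) / GL_n(R)₀`. -/
abbrev Pi0GL (n : ℕ) : Type _ := GLn R n ⧸ Subgroup.connectedComponentOfOne (GLn R n)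

variable {R S T}

/-- The upper left corner embedding `M ↦ M ⊕ 1`. -/
def stabMatrix {n m : ℕ} (M : Matrix (Fin n) (Fin n) R) : Matrix (Fin m) (Fin m) R :=
  Matrix.of fun i j =>
    if h : (i : ℕ) < n ∧ (j : ℕ) < n then M ⟨i, h.1⟩ ⟨j, h.2⟩ else if i = j then 1 else 0

variable (R) in
/-- The upper left corner embedding as a homomorphism of multiplicative monoids. -/
def stabHom {n m : ℕ} (h : n ≤ m) :
    Matrix (Fin n) (Fin n) R →* Matrix (Fin m) (Fin m) R where
  toFun := stabMatrix
  map_one' := by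
    ext i j
    simp only [stabMatrix, Matrix.of_apply, Matrix.one_apply, Fin.ext_iff]
    split_ifs <;> rfl
  map_mul' M N := by
    obtain ⟨k, rfl⟩ := Nat.exists_eq_add_of_le h
    have d : ∀ (x : Fin n) (y : Fin k), Fin.castAdd k x ≠ Fin.natAdd n y := by
      intro x y hxy
      have := congrArg Fin.val hxy
      simp only [Fin.val_castAdd, Fin.val_natAdd] at this
      omega
    have d' : ∀ (x : Fin n) (y : Fin k), Fin.natAdd n y ≠ Fin.castAdd k x :=
      fun x y => (d x y).symm
    ext i j
    rw [Matrix.mul_apply, Fin.sum_univ_add]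
    induction i using Fin.addCases <;> induction j using Fin.addCases <;>
      simp [stabMatrix, Matrix.mul_apply, d, d']

theorem continuous_stabHom {n m : ℕ} (h : n ≤ m) : Continuous (stabHom R h) := by
  refine continuous_matrix fun i j => ?_
  simp only [stabHom, stabMatrix, MonoidHom.coe_mk, OneHom.coe_mk, Matrix.of_apply]
  split_ifs <;> fun_prop

theorem map_component {G H : Type*} [Group G] [TopologicalSpace G] [IsTopologicalGroup G]
    [Group H] [TopologicalSpace H] [IsTopologicalGroup H] (f : G →* H) (hf : Continuous f) :
    Subgroup.connectedComponentOfOne G ≤ (Subgroup.connectedComponentOfOne H).comap f := by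
  intro u hu
  have := hf.image_connectedComponent_subset 1 ⟨u, hu, rfl⟩
  rwa [map_one] at this

variable (R) in
/-- The stabilisation `π₀(GL_n(R)) → π₀(GL_m(R))`. -/
def stabPi0 (n m : ℕ) (h : n ≤ m) : Pi0GL R n →* Pi0GL R m :=
  QuotientGroup.map _ _ (Units.map (stabHom R h))
    (map_component _ ((continuous_stabHom h).units_map _))

instance : DirectedSystem (Pi0GL R) (stabPi0 R · · ·) where
  map_self n x := by
    induction x using QuotientGroup.induction_on with | _ u => ?_
    refine congrArg _ (Units.ext ?_)
    ext i j
    simp [stabHom, stabMatrix]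
  map_map n m k h h' x := by
    induction x using QuotientGroup.induction_on with | _ u => ?_
    refine congrArg _ (Units.ext ?_)
    ext i j
    simp only [stabHom, stabMatrix, Units.coe_map, MonoidHom.coe_mk, OneHom.coe_mk,
      Matrix.of_apply, Fin.ext_iff]
    grind

variable (R) in
/-- Topological `K₁` of a unital Banach algebra: the direct limit of the groups
`π₀(GL_n(R))` along `u ↦ u ⊕ 1`. -/
abbrev K1Unital : Type _ := DirectLimit (Pi0GL R) (stabPi0 R)

/-- The map `π₀(GL_n(R)) → π₀(GL_n(S))` induced by a continuous unital ring homomorphism. -/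
def Pi0GL.map (f : R →+* S) (hf : Continuous f) (n : ℕ) : Pi0GL R n →* Pi0GL S n :=
  QuotientGroup.map _ _ (Units.map (f.mapMatrix : Matrix (Fin n) (Fin n) R →+* _).toMonoidHom)
    (map_component _ (Continuous.units_map (f.mapMatrix : Matrix (Fin n) (Fin n) R →+* _).toMonoidHom
      (continuous_id.matrix_map hf)))

/-- The homomorphism `K₁(R) → K₁(S)` induced by a continuous unital ring homomorphism. -/
noncomputable def K1Unital.map (f : R →+* S) (hf : Continuous f) : K1Unital R →* K1Unital S where
  toFun := DirectLimit.map _ _ (fun n => Pi0GL.map f hf n) (by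
    intro n m h x
    induction x using QuotientGroup.induction_on with | _ u => ?_
    refine congrArg _ (Units.ext ?_)
    ext i j
    simp [stabHom, stabMatrix]
    split_ifs <;> simp)
  map_one' := by
    rw [DirectLimit.one_def 0, DirectLimit.map_def, map_one, ← DirectLimit.one_def]
  map_mul' x y := by
    induction x, y using DirectLimit.induction₂ with | _ n x y => ?_
    simp only [DirectLimit.mul_def, DirectLimit.map_def, map_mul]

theorem K1Unital.map_map (g : S →+* T) (hg : Continuous g) (f : R →+* S) (hf : Continuous f)
    (x : K1Unital R) :
    K1Unital.map g hg (K1Unital.map f hf x) = K1Unital.map (g.comp f) (hg.comp hf) x := by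
  induction x using DirectLimit.induction with | _ n x => ?_
  induction x using QuotientGroup.induction_on with | _ u => rfl

end KOne

section NonUnital

variable (A : Type*) [NonUnitalNormedRing A] [NormedSpace ℂ A] [IsScalarTower ℂ A A]
  [SMulCommClass ℂ A A]
variable {B : Type*} [NonUnitalNormedRing B] [NormedSpace ℂ B] [IsScalarTower ℂ B B]
  [SMulCommClass ℂ B B]

/-- The unitalisation `A⁺ = ℂ ⊕ A` with the norm `|z| + ‖a‖`. -/
abbrev Plus : Type _ := WithLp 1 (Unitization ℂ A)

/-- The augmentation `A⁺ → ℂ`, `z + a ↦ z`. -/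
noncomputable def augmentation : Plus A →+* ℂ :=
  (((Unitization.fstHom ℂ A).comp
    (WithLp.unitizationAlgEquiv (𝕜 := ℂ) (A := A) ℂ).toAlgHom : Plus A →ₐ[ℂ] ℂ) : Plus A →+* ℂ)

theorem continuous_augmentation : Continuous (augmentation A) := by
  refine AddMonoidHomClass.continuous_of_bound (augmentation A) 1 fun x => ?_
  rw [one_mul, WithLp.unitization_norm_def]
  exact le_add_of_nonneg_right (norm_nonneg _)

variable {A}

/-- The unital extension `φ⁺ : A⁺ → B⁺`, `z + a ↦ z + φ(a)`. -/
noncomputable def plusMap (φ : A →ₙₐ[ℂ] B) : Plus A →+* Plus B :=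
  (((WithLp.unitizationAlgEquiv (𝕜 := ℂ) (A := B) ℂ).symm.toAlgHom.comp
    ((Unitization.lift ((Unitization.inrNonUnitalAlgHom ℂ B).comp φ)).comp
      (WithLp.unitizationAlgEquiv (𝕜 := ℂ) (A := A) ℂ).toAlgHom) :
        Plus A →ₐ[ℂ] Plus B) : Plus A →+* Plus B)

theorem plusMap_apply (φ : A →ₙₐ[ℂ] B) (x : Plus A) :
    plusMap φ x = WithLp.toLp 1
      (Unitization.inl (WithLp.ofLp x).fst + Unitization.inr (φ (WithLp.ofLp x).snd)) := rfl

theorem augmentation_comp_plusMap (φ : A →ₙₐ[ℂ] B) :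
    (augmentation B).comp (plusMap φ) = augmentation A := by
  ext x
  change (Unitization.inl (WithLp.ofLp x).fst +
    Unitization.inr (φ (WithLp.ofLp x).snd) : Unitization ℂ B).fst = (WithLp.ofLp x).fst
  simp

theorem continuous_plusMap (φ : A →ₙₐ[ℂ] B) (hφ : Continuous φ) : Continuous (plusMap φ) := by
  have hA := (WithLp.uniformEquiv_unitization_addEquiv_prod ℂ A).continuous
  have hB := (WithLp.uniformEquiv_unitization_addEquiv_prod ℂ B).symm.continuous
  have h1 : Continuous fun x : Plus A => (WithLp.ofLp x).fst :=
    continuous_fst.comp ((WithLp.prod_continuous_ofLp 1 ℂ A).comp hA)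
  have h2 : Continuous fun x : Plus A => (WithLp.ofLp x).snd :=
    continuous_snd.comp ((WithLp.prod_continuous_ofLp 1 ℂ A).comp hA)
  have h3 := hB.comp ((WithLp.prod_continuous_toLp 1 ℂ B).comp (h1.prodMk (hφ.comp h2)))
  refine h3.congr fun x => ?_
  rw [plusMap_apply]
  refine congrArg (WithLp.toLp 1) (Unitization.ext ?_ ?_)
  · rw [Unitization.fst_add, Unitization.fst_inl, Unitization.fst_inr, add_zero]
    rfl
  · rw [Unitization.snd_add, Unitization.snd_inl, Unitization.snd_inr, zero_add]
    rfl

variable (A) in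
/-- `K₀(A) = ker (K₀(A⁺) → K₀(ℂ))`. -/
noncomputable def K0 : AddSubgroup (K0Unital (Plus A)) := (K0Unital.map (augmentation A)).ker

variable (A) in
/-- `K₁(A) = ker (K₁(A⁺) → K₁(ℂ))`. -/
noncomputable def K1 : Subgroup (K1Unital (Plus A)) :=
  (K1Unital.map (augmentation A) (continuous_augmentation A)).ker

/-- `φ_* : K₀(A) → K₀(B)`. -/
noncomputable def K0.map (φ : A →ₙₐ[ℂ] B) : K0 A →+ K0 B :=
  ((K0Unital.map (plusMap φ)).comp (K0 A).subtype).codRestrict (K0 B) fun x => by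
    change K0Unital.map (augmentation B) (K0Unital.map (plusMap φ) x) = 0
    rw [K0Unital.map_map, augmentation_comp_plusMap]
    exact x.2

/-- `φ_* : K₁(A) → K₁(B)`. -/
noncomputable def K1.map (φ : A →ₙₐ[ℂ] B) (hφ : Continuous φ) : K1 A →* K1 B :=
  ((K1Unital.map (plusMap φ) (continuous_plusMap φ hφ)).comp (K1 A).subtype).codRestrict (K1 B)
    fun x => by
      change K1Unital.map (augmentation B) (continuous_augmentation B)
        (K1Unital.map (plusMap φ) (continuous_plusMap φ hφ) x) = 1
      rw [K1Unital.map_map]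
      simp only [augmentation_comp_plusMap]
      exact x.2

end NonUnital

end BanachK

set_option linter.unusedSectionVars false

/-! ### Quasi-regularity and spectral radii -/

section Quasiregular

variable {A : Type*} [NonUnitalNormedRing A] [NormedSpace ℂ A] [IsScalarTower ℂ A A]
  [SMulCommClass ℂ A A]

/-! Everything rests on one local-to-global principle: `1 + a` is invertible in the unitalisation of
`A` exactly when every `1 + a_x` is invertible in that of `A_x` (`isQuasiregular_iff_fibre`). If `1
+ b` lifts a left inverse of `1 + a_x`, then `(1 + b)(1 + a) = 1 + c` with `c_x = 0`. Fibre norms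
are approximated by norms of cut-offs, so `χ • c` is small for some `χ` equal to `1` near `x`, and a
Neumann series corrects `b` to a left inverse of `1 + a` near `x`. Such local left inverses glue
over a compact set, and outside a suitable compact set `a` is small by non-degeneracy. Two-sidedness
is recovered at the end.

Consequently the spectral radius of `a` is the supremum of the radii of the `a_x`, which gives
isoradiality of `φ` from its fibres. A quasi-inverse of `ι(a)` in the Gelfand transform evaluates to
a quasi-inverse of each `a_x`, so `ι` is isoradial as well. The same gluing of cut-offs, applied to
local approximations of a section, shows that `ι` has dense range and, if all `φ_x` have dense
range, that `ι ∘ φ` has dense range too.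

For K-theory, a full homomorphism extends to a map of unitalisations that has dense range and
reflects invertibility. Schur complements carry this to matrices (`isLocalHom_mapMatrix`). A dense
map reflecting units is bijective on classes of idempotents and on components of general linear
groups: approximate idempotents are corrected by a power series that converges under a bound on the
spectral radius alone, and connected components are compared through straight segments and an
open-closed subgroup. Hence `ι` and `ι ∘ φ` induce isomorphisms, and two-out-of-three gives the
result for `φ`. The detour through `ι` is needed because gluing controls only the supremum norm of
the fibres. -/

theorem isQuasiregular_of_norm_lt_one [CompleteSpace A] {a : A} (ha : ‖a‖ < 1) :
    IsQuasiregular a := by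
  rw [isQuasiregular_iff_isUnit' ℂ]
  -- The Neumann series is summed in the `ℓ¹` unitalisation, which is complete and whose norm
  -- restricts to that of `A`.
  have h : IsUnit (1 - WithLp.toLp 1 (-(a : Unitization ℂ A)) : BanachK.Plus A) := by
    refine isUnit_one_sub_of_norm_lt_one ?_
    rw [WithLp.unitization_norm_def]
    simpa using ha
  have := h.map (WithLp.unitizationAlgEquiv (𝕜 := ℂ) (A := A) ℂ)
  rw [map_sub, map_one] at this
  simpa using this

/-- The spectrum in the unitalisation is the quasispectrum, and its point `0` never affects the
radius. This turns radii into statements about quasi-regularity of `-(z⁻¹ • a)`, the only property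
that the fibres need to detect. -/
theorem banachSpectralRadius_le_iff {a : A} {r : ℝ≥0∞} :
    banachSpectralRadius a ≤ r ↔
      ∀ z : ℂˣ, ¬ IsQuasiregular (-(z⁻¹ • a)) → (‖(z : ℂ)‖₊ : ℝ≥0∞) ≤ r := by
  rw [banachSpectralRadius, spectralRadius, ← Unitization.quasispectrum_eq_spectrum_inr ℂ a,
    iSup₂_le_iff]
  refine ⟨fun h z hz => h z (quasispectrum.mem_of_not_quasiregular a hz), fun h z hz => ?_⟩
  by_cases hz0 : z = 0
  · simp [hz0]
  · have hu : IsUnit z := isUnit_iff_ne_zero.2 hz0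
    exact h hu.unit (hz hu)

theorem isQuasiregular_of_radius_lt {a : A} {z : ℂˣ}
    (h : banachSpectralRadius a < ‖(z : ℂ)‖₊) : IsQuasiregular (-(z⁻¹ • a)) := by
  by_contra hz
  exact absurd (banachSpectralRadius_le_iff.1 le_rfl z hz) (not_le.2 h)

theorem banachSpectralRadius_le_norm [CompleteSpace A] (a : A) :
    banachSpectralRadius a ≤ ‖a‖₊ := by
  refine banachSpectralRadius_le_iff.2 fun z hz => ?_
  by_contra hlt
  refine hz (isQuasiregular_of_norm_lt_one ?_)
  have hlt' : ‖a‖ < ‖(z : ℂ)‖ := by exact_mod_cast not_le.1 hlt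
  have hz0 : 0 < ‖(z : ℂ)‖ := (norm_nonneg _).trans_lt hlt'
  rw [norm_neg, Units.smul_def, norm_smul, Units.val_inv_eq_inv_val, norm_inv,
    inv_mul_lt_iff₀ hz0, mul_one]
  exact hlt'

end Quasiregular

namespace C0BanachAlgebra

/-! ### Cut-off functions -/

section Cutoff

variable {X : Type*} [TopologicalSpace X]

/-- Functions in `C₀(X)` with values in the real interval `[0, 1]`. -/
def IsCutoff (χ : C₀(X, ℂ)) : Prop := ∀ v, ∃ t ∈ Set.Icc (0 : ℝ) 1, χ v = t

theorem norm_le_of_forall {χ : C₀(X, ℂ)} {C : ℝ} (hC : 0 ≤ C) (h : ∀ v, ‖χ v‖ ≤ C) : ‖χ‖ ≤ C :=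
  (BoundedContinuousFunction.norm_le (f := χ.toBCF) hC).2 h

theorem IsCutoff.norm_le {χ : C₀(X, ℂ)} (h : IsCutoff χ) : ‖χ‖ ≤ 1 := by
  refine norm_le_of_forall zero_le_one fun v => ?_
  obtain ⟨t, ht, e⟩ := h v
  rw [e, Complex.norm_real, Real.norm_of_nonneg ht.1]
  exact ht.2

theorem IsCutoff.zero : IsCutoff (0 : C₀(X, ℂ)) := fun _ => ⟨0, by simp, by simp⟩

theorem IsCutoff.mul {χ ψ : C₀(X, ℂ)} (h : IsCutoff χ) (h' : IsCutoff ψ) : IsCutoff (χ * ψ) := by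
  intro v
  obtain ⟨t, ht, e⟩ := h v
  obtain ⟨s, hs, e'⟩ := h' v
  exact ⟨t * s, ⟨mul_nonneg ht.1 hs.1, mul_le_one₀ ht.2 hs.1 hs.2⟩, by simp [e, e']⟩

/-- Since `1 - (χ + ψ - χψ) = (1 - χ)(1 - ψ)`, the new function equals `1` wherever one of the two
does. It replaces partitions of unity throughout the gluing arguments. -/
theorem IsCutoff.union {χ ψ : C₀(X, ℂ)} (h : IsCutoff χ) (h' : IsCutoff ψ) :
    IsCutoff (χ + (ψ - χ * ψ)) := by
  intro v
  obtain ⟨t, ht, e⟩ := h v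
  obtain ⟨s, hs, e'⟩ := h' v
  refine ⟨t + (s - t * s), ⟨?_, ?_⟩, by simp [e, e']⟩
  · nlinarith [ht.1, ht.2, hs.1, hs.2, mul_nonneg (sub_nonneg.2 ht.2) hs.1]
  · nlinarith [mul_nonneg (sub_nonneg.2 ht.2) (sub_nonneg.2 hs.2)]

theorem exists_cutoff [LocallyCompactSpace X] [T2Space X] {K U : Set X} (hK : IsCompact K)
    (hU : IsOpen U) (hKU : K ⊆ U) :
    ∃ χ : C₀(X, ℂ), IsCutoff χ ∧ (∀ v ∈ K, χ v = 1) ∧ (∀ v, v ∉ U → χ v = 0) ∧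
      HasCompactSupport χ := by
  obtain ⟨f, hf1, hf0, hfc, hf⟩ := exists_continuous_one_zero_of_isCompact hK
    hU.isClosed_compl (Set.disjoint_compl_right_iff_subset.2 hKU)
  have h0 : HasCompactSupport fun x => (f x : ℂ) := hfc.comp_left Complex.ofReal_zero
  refine ⟨⟨⟨fun x => (f x : ℂ), by fun_prop⟩, h0.is_zero_at_infty⟩, fun v => ⟨f v, hf v, rfl⟩,
    fun v hv => ?_, fun v hv => ?_, h0⟩
  · change (f v : ℂ) = 1
    simp [hf1 hv]
  · change (f v : ℂ) = 0
    simp [hf0 hv]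

theorem exists_cutoff_nhds [LocallyCompactSpace X] [T2Space X] {x : X} {U : Set X}
    (hU : U ∈ 𝓝 x) :
    ∃ χ : C₀(X, ℂ), IsCutoff χ ∧ (∀ᶠ v in 𝓝 x, χ v = 1) ∧ (∀ v, v ∉ U → χ v = 0) := by
  obtain ⟨K, hK, hKU, hKc⟩ := local_compact_nhds (interior_mem_nhds.2 hU)
  obtain ⟨χ, h, h1, h0, -⟩ := exists_cutoff hKc isOpen_interior hKU
  exact ⟨χ, h, Filter.mem_of_superset hK h1, fun v hv => h0 v fun h => hv (interior_subset h)⟩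

end Cutoff

/-! ### Elementary rules for the action of `C₀(X)` -/

section Module

variable {X A : Type*} [TopologicalSpace X] [NonUnitalNormedRing A] [NormedSpace ℂ A]
  [C0BanachAlgebra X A]

theorem sub_smul' (χ ψ : C₀(X, ℂ)) (a : A) : (χ - ψ) • a = χ • a - ψ • a := by
  rw [sub_eq_add_neg, add_smul', ← neg_one_smul ℂ ψ, smul_smul_left', neg_one_smul,
    ← sub_eq_add_neg]

theorem smul_sub' (χ : C₀(X, ℂ)) (a b : A) : χ • (a - b) = χ • a - χ • b := by
  rw [sub_eq_add_neg, smul_add', ← neg_one_smul ℂ b, smul_smul_right', neg_one_smul,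
    ← sub_eq_add_neg]

theorem zero_smul' (a : A) : (0 : C₀(X, ℂ)) • a = 0 := by
  simpa using smul_smul_left' (0 : ℂ) (0 : C₀(X, ℂ)) a

theorem smul_zero' (χ : C₀(X, ℂ)) : χ • (0 : A) = 0 := by
  simpa using smul_smul_right' (0 : ℂ) χ (0 : A)

theorem IsCutoff.norm_smul_le {χ : C₀(X, ℂ)} (h : IsCutoff χ) (a : A) : ‖χ • a‖ ≤ ‖a‖ :=
  (norm_smul_le' χ a).trans (mul_le_of_le_one_left (norm_nonneg a) h.norm_le)

end Module

/-! ### Fibre norms as limits of norms of cut-offs -/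

section Local

variable {X A : Type*} [TopologicalSpace X] [NonUnitalNormedRing A] [NormedSpace ℂ A]
  [IsScalarTower ℂ A A] [SMulCommClass ℂ A A] [C0BanachAlgebra X A]

/-- A generator `ψ • a` with `ψ x = 0` becomes small once cut off to a region where `ψ` is small.
Sums are handled by multiplying cut-offs, and closures because cut-offs act contractively. -/
theorem exists_cutoff_smul_lt_of_mem_fibreIdeal [LocallyCompactSpace X] [T2Space X] {x : X} {k : A}
    (hk : k ∈ fibreIdeal X A x) {δ : ℝ} (hδ : 0 < δ) :
    ∃ χ : C₀(X, ℂ), IsCutoff χ ∧ (∀ᶠ v in 𝓝 x, χ v = 1) ∧ ‖χ • k‖ < δ := by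
  obtain ⟨k', hk', hd⟩ := Metric.mem_closure_iff.1 hk (δ / 2) (half_pos hδ)
  suffices h : ∀ δ > 0, ∃ χ : C₀(X, ℂ), IsCutoff χ ∧ (∀ᶠ v in 𝓝 x, χ v = 1) ∧ ‖χ • k'‖ < δ by
    obtain ⟨χ, h1, h2, h3⟩ := h (δ / 2) (half_pos hδ)
    refine ⟨χ, h1, h2, ?_⟩
    have h4 := h1.norm_smul_le (k - k')
    rw [dist_eq_norm] at hd
    calc ‖χ • k‖ = ‖χ • (k - k') + χ • k'‖ := by rw [← smul_add', sub_add_cancel]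
      _ < δ := (norm_add_le _ _).trans_lt (by linarith)
  clear hd
  refine Submodule.span_induction (p := fun k _ => ∀ δ > 0, ∃ χ : C₀(X, ℂ), IsCutoff χ ∧
    (∀ᶠ v in 𝓝 x, χ v = 1) ∧ ‖χ • k‖ < δ) ?_ ?_ ?_ ?_ hk'
  · rintro _ ⟨ψ, a, hψ, rfl⟩ δ hδ
    have hη : 0 < δ / (‖a‖ + 1) := by positivity
    have hU : {v | ‖ψ v‖ < δ / (‖a‖ + 1)} ∈ 𝓝 x := by
      refine (map_continuous ψ).norm.continuousAt.eventually (gt_mem_nhds ?_)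
      simpa [hψ] using hη
    obtain ⟨χ, h1, h2, h3⟩ := exists_cutoff_nhds hU
    refine ⟨χ, h1, h2, ?_⟩
    have h4 : ‖χ * ψ‖ ≤ δ / (‖a‖ + 1) := by
      refine norm_le_of_forall hη.le fun v => ?_
      by_cases hv : ‖ψ v‖ < δ / (‖a‖ + 1)
      · rw [ZeroAtInftyContinuousMap.mul_apply, norm_mul]
        exact (mul_le_of_le_one_left (norm_nonneg _)
          ((χ.toBCF.norm_coe_le_norm v).trans h1.norm_le)).trans hv.le
      · rw [ZeroAtInftyContinuousMap.mul_apply, h3 v hv, zero_mul, norm_zero]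
        exact hη.le
    rw [← mul_smul']
    calc ‖(χ * ψ) • a‖ ≤ δ / (‖a‖ + 1) * ‖a‖ :=
          (norm_smul_le' _ _).trans (by gcongr)
      _ < δ / (‖a‖ + 1) * (‖a‖ + 1) := by gcongr; linarith
      _ = δ := div_mul_cancel₀ _ (by positivity)
  · intro δ hδ
    obtain ⟨χ, h1, h2, -⟩ := exists_cutoff_nhds (Filter.univ_mem (f := 𝓝 x))
    exact ⟨χ, h1, h2, by rwa [smul_zero', norm_zero]⟩
  · intro k l _ _ hk hl δ hδ
    obtain ⟨χ, h1, h2, h3⟩ := hk (δ / 2) (half_pos hδ)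
    obtain ⟨ψ, h1', h2', h3'⟩ := hl (δ / 2) (half_pos hδ)
    refine ⟨χ * ψ, h1.mul h1', ?_, ?_⟩
    · filter_upwards [h2, h2'] with v hv hv'
      simp [hv, hv']
    · have e1 : ‖(χ * ψ) • k‖ ≤ ‖χ • k‖ := by
        rw [mul_comm, mul_smul']
        exact h1'.norm_smul_le _
      have e2 : ‖(χ * ψ) • l‖ ≤ ‖ψ • l‖ := by
        rw [mul_smul']
        exact h1.norm_smul_le _
      rw [smul_add']
      exact (norm_add_le _ _).trans_lt (by linarith)
  · intro z k _ hk δ hδ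
    obtain ⟨χ, h1, h2, h3⟩ := hk (δ / (‖z‖ + 1)) (by positivity)
    refine ⟨χ, h1, h2, ?_⟩
    rw [smul_smul_right', norm_smul]
    calc ‖z‖ * ‖χ • k‖ ≤ ‖z‖ * (δ / (‖z‖ + 1)) := by gcongr
      _ < (‖z‖ + 1) * (δ / (‖z‖ + 1)) := by gcongr; linarith
      _ = δ := mul_div_cancel₀ _ (by positivity)

/-- The quotient norm supplies a representative `b` of `a_x` with `‖b‖ < ε`. The difference `a - b`
lies in the fibre ideal, and a narrow cut-off makes it smaller than the remaining slack `ε - ‖b‖`.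
-/
theorem exists_cutoff_smul_lt [LocallyCompactSpace X] [T2Space X] {x : X} {a : A} {ε : ℝ}
    (h : ‖fibreMk X A x a‖ < ε) :
    ∃ χ : C₀(X, ℂ), IsCutoff χ ∧ (∀ᶠ v in 𝓝 x, χ v = 1) ∧ ‖χ • a‖ < ε := by
  obtain ⟨b, hb, hbε⟩ : ∃ b, fibreMk X A x b = fibreMk X A x a ∧
      ‖b‖ < ‖fibreMk X A x a‖ + (ε - ‖fibreMk X A x a‖) :=
    Submodule.Quotient.norm_mk_lt _ (sub_pos.2 h)
  rw [add_sub_cancel] at hbε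
  have hk : a - b ∈ fibreIdeal X A x := (Submodule.Quotient.eq _).1 hb.symm
  obtain ⟨χ, h1, h2, h3⟩ := exists_cutoff_smul_lt_of_mem_fibreIdeal hk (sub_pos.2 hbε)
  refine ⟨χ, h1, h2, ?_⟩
  have h4 := h1.norm_smul_le b
  calc ‖χ • a‖ = ‖χ • (a - b) + χ • b‖ := by rw [← smul_add', sub_add_cancel]
    _ < ε := (norm_add_le _ _).trans_lt (by linarith)

/-- The norm function `v ↦ ‖a_v‖` is upper semi-continuous. -/
theorem eventually_norm_fibreMk_lt [LocallyCompactSpace X] [T2Space X] {x : X} {a : A} {ε : ℝ}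
    (h : ‖fibreMk X A x a‖ < ε) : ∀ᶠ v in 𝓝 x, ‖fibreMk X A v a‖ < ε := by
  obtain ⟨χ, -, h2, h3⟩ := exists_cutoff_smul_lt h
  filter_upwards [h2] with v hv
  have := norm_fibreMk_le X A v (χ • a)
  rw [fibreMk_smul, hv, one_smul] at this
  exact this.trans_lt h3

variable (X) in
-- Non-degeneracy reduces this to `a = χ • c`, where `K` can be any compact set off which `χ` is
-- small. One `K` works for all cut-offs `Ψ` equal to `1` on it, so `Ψ` can be constructed
-- afterwards by gluing.
theorem exists_compact_norm_sub_smul_lt [LocallyCompactSpace X] [T2Space X] (a : A) {ε : ℝ}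
    (hε : 0 < ε) :
    ∃ K : Set X, IsCompact K ∧ ∀ Ψ : C₀(X, ℂ), IsCutoff Ψ → (∀ v ∈ K, Ψ v = 1) →
      ‖a - Ψ • a‖ < ε := by
  obtain ⟨b, hb, hbs⟩ := Metric.dense_iff.1 (nondegenerate' (X := X) (A := A)) a (ε / 3)
    (by positivity)
  rw [Metric.mem_ball, dist_comm, dist_eq_norm] at hb
  suffices h : ∀ ε > 0, ∃ K : Set X, IsCompact K ∧ ∀ Ψ : C₀(X, ℂ), IsCutoff Ψ →
      (∀ v ∈ K, Ψ v = 1) → ‖b - Ψ • b‖ ≤ ε by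
    obtain ⟨K, hK, hΨ⟩ := h (ε / 3) (by positivity)
    refine ⟨K, hK, fun Ψ h1 h2 => ?_⟩
    have h3 := hΨ Ψ h1 h2
    have h4 := h1.norm_smul_le (a - b)
    have e : a - Ψ • a = (a - b) - Ψ • (a - b) + (b - Ψ • b) := by rw [smul_sub']; abel
    rw [e]
    refine (norm_add_le _ _).trans_lt ?_
    have := norm_sub_le (a - b) (Ψ • (a - b))
    linarith
  clear hb
  refine Submodule.span_induction (p := fun b _ => ∀ ε > 0, ∃ K : Set X, IsCompact K ∧
    ∀ Ψ : C₀(X, ℂ), IsCutoff Ψ → (∀ v ∈ K, Ψ v = 1) → ‖b - Ψ • b‖ ≤ ε) ?_ ?_ ?_ ?_ hbs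
  · rintro _ ⟨χ, c, rfl⟩ ε hε
    have hη : 0 < ε / (‖c‖ + 1) := by positivity
    obtain ⟨K, hK, hK'⟩ := Filter.mem_cocompact.1
      ((zero_at_infty χ).norm.eventually (gt_mem_nhds (by rwa [norm_zero] : ‖(0 : ℂ)‖ < _)))
    refine ⟨K, hK, fun Ψ h1 h2 => ?_⟩
    have h4 : ‖χ - Ψ * χ‖ ≤ ε / (‖c‖ + 1) := by
      refine norm_le_of_forall hη.le fun v => ?_
      rw [ZeroAtInftyContinuousMap.sub_apply, ZeroAtInftyContinuousMap.mul_apply]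
      by_cases hv : v ∈ K
      · rw [h2 v hv, one_mul, sub_self, norm_zero]
        exact hη.le
      · obtain ⟨t, ht, e⟩ := h1 v
        have hχ : ‖χ v‖ < ε / (‖c‖ + 1) := hK' hv
        have e' : χ v - Ψ v * χ v = ((1 - t : ℝ) : ℂ) * χ v := by rw [e]; push_cast; ring
        rw [e', norm_mul, Complex.norm_real, Real.norm_of_nonneg (sub_nonneg.2 ht.2)]
        exact (mul_le_of_le_one_left (norm_nonneg _) (by linarith [ht.1])).trans hχ.le
    rw [← mul_smul', ← sub_smul']
    calc ‖(χ - Ψ * χ) • c‖ ≤ ε / (‖c‖ + 1) * ‖c‖ :=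
          (norm_smul_le' _ _).trans (by gcongr)
      _ ≤ ε / (‖c‖ + 1) * (‖c‖ + 1) := by gcongr; linarith
      _ = ε := div_mul_cancel₀ _ (by positivity)
  · intro ε hε
    exact ⟨∅, isCompact_empty, fun Ψ _ _ => by rw [smul_zero', sub_zero, norm_zero]; exact hε.le⟩
  · intro b c _ _ hb hc ε hε
    obtain ⟨K, hK, h1⟩ := hb (ε / 2) (half_pos hε)
    obtain ⟨L, hL, h2⟩ := hc (ε / 2) (half_pos hε)
    refine ⟨K ∪ L, hK.union hL, fun Ψ h3 h4 => ?_⟩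
    have h5 := h1 Ψ h3 fun v hv => h4 v (Or.inl hv)
    have h6 := h2 Ψ h3 fun v hv => h4 v (Or.inr hv)
    rw [smul_add', add_sub_add_comm]
    exact (norm_add_le _ _).trans (by linarith)
  · intro z b _ hb ε hε
    obtain ⟨K, hK, h1⟩ := hb (ε / (‖z‖ + 1)) (by positivity)
    refine ⟨K, hK, fun Ψ h3 h4 => ?_⟩
    rw [smul_smul_right', ← smul_sub, norm_smul]
    calc ‖z‖ * ‖b - Ψ • b‖ ≤ (‖z‖ + 1) * (ε / (‖z‖ + 1)) := by
          gcongr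
          · linarith
          · exact h1 Ψ h3 h4
      _ = ε := mul_div_cancel₀ _ (by positivity)

/-! ### Quasi-regularity is detected by the fibres -/

/-- The functions `χ ∈ C₀(X)` with `χ A ⊆ A (1 + a)`. -/
def InvertsLeft (a : A) (χ : C₀(X, ℂ)) : Prop := ∀ d : A, ∃ g : A, χ • d = g + g * a

/-- Multiplication by `χ` commutes with right multiplication by `1 + a`. Hence solutions `g` for `χ
• d` and `k` for `ψ • d` combine to `g + (1 - χ) k`. -/
theorem InvertsLeft.union {a : A} {χ ψ : C₀(X, ℂ)} (h : InvertsLeft a χ) (h' : InvertsLeft a ψ) :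
    InvertsLeft a (χ + (ψ - χ * ψ)) := by
  intro d
  obtain ⟨g, hg⟩ := h d
  obtain ⟨k, hk⟩ := h' d
  refine ⟨g + (k - χ • k), ?_⟩
  rw [add_smul', sub_smul', mul_smul', hg, hk, smul_add', smul_mul']
  noncomm_ring

/-- Around every point `x` at which `1 + a_x` is left invertible, `1 + a` is left invertible. -/
theorem exists_invertsLeft [LocallyCompactSpace X] [T2Space X] [CompleteSpace A] {a b : A} {x : X}
    (h : fibreMk X A x (b + a + b * a) = 0) :
    ∃ ψ : C₀(X, ℂ), IsCutoff ψ ∧ (∀ᶠ v in 𝓝 x, ψ v = 1) ∧ InvertsLeft a ψ := by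
  set c := b + a + b * a with hc
  -- Here `(1 + b)(1 + a) = 1 + c` with `c_x = 0`, so `1 + χ • c` is invertible for a suitable `χ`,
  -- with inverse `1 + e`.
  obtain ⟨χ, -, h2, h3⟩ := exists_cutoff_smul_lt (show ‖fibreMk X A x c‖ < 1 by simp [h])
  obtain ⟨e, -, he⟩ := isQuasiregular_iff.1 (isQuasiregular_of_norm_lt_one h3)
  obtain ⟨ψ, h1', h2', h3'⟩ := exists_cutoff_nhds h2
  refine ⟨ψ, h1', h2', fun d => ?_⟩
  have hχψ : χ * ψ = ψ := by
    ext v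
    by_cases hv : χ v = 1
    · simp [hv]
    · simp [h3' v hv]
  set D := ψ • d with hD
  have hχD : χ • D = D := by rw [hD, ← mul_smul', hχψ]
  have e1 : D * (χ • c) = D * c := by rw [← mul_smul_comm', smul_mul', hχD]
  have e2 : D * e * (χ • c) = D * e * c := by rw [← mul_smul_comm', smul_mul', smul_mul', hχD]
  -- The witness is `D (1 + e)(1 + b)`. Because `χ • D = D`, the elements `c` and `χ • c` agree
  -- after multiplication by `D` or `D * e`, so `D (1 + e)(1 + c) = D`.
  refine ⟨D + D * e + D * b + D * e * b, ?_⟩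
  have e3 : D * e + D * c + D * e * c = 0 := by
    have := congrArg (D * ·) he
    simp only [mul_add, ← mul_assoc, e1, e2, mul_zero] at this
    rw [← this]
    abel
  calc D = D + (D * e + D * c + D * e * c) := by rw [e3, add_zero]
    _ = _ := by rw [hc]; noncomm_ring

theorem exists_left_quasiInverse [LocallyCompactSpace X] [T2Space X] [CompleteSpace A] (a : A)
    (h : ∀ x : X, ∃ b : A, fibreMk X A x (b + a + b * a) = 0) : ∃ b : A, b + a + b * a = 0 := by
  obtain ⟨K, hK, hΨK⟩ := exists_compact_norm_sub_smul_lt X a one_pos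
  obtain ⟨Ψ, h1, h2, h3⟩ : ∃ Ψ : C₀(X, ℂ), IsCutoff Ψ ∧ InvertsLeft a Ψ ∧ ∀ v ∈ K, Ψ v = 1 := by
    refine IsCompact.induction_on hK
      (p := fun s => ∃ Ψ : C₀(X, ℂ), IsCutoff Ψ ∧ InvertsLeft a Ψ ∧ ∀ v ∈ s, Ψ v = 1) ?_ ?_ ?_ ?_
    · exact ⟨0, IsCutoff.zero, fun d => ⟨0, by simp [zero_smul']⟩, by simp⟩
    · rintro s t hst ⟨Ψ, h1, h2, h3⟩
      exact ⟨Ψ, h1, h2, fun v hv => h3 v (hst hv)⟩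
    · rintro s t ⟨χ, h1, h2, h3⟩ ⟨ψ, h1', h2', h3'⟩
      refine ⟨_, h1.union h1', h2.union h2', ?_⟩
      rintro v (hv | hv)
      · simp [h3 v hv]
      · simp [h3' v hv]
    · intro x _
      obtain ⟨b, hb⟩ := h x
      obtain ⟨ψ, h1, h2, h3⟩ := exists_invertsLeft hb
      exact ⟨_, mem_nhdsWithin_of_mem_nhds h2, ψ, h1, h3, fun v hv => hv⟩
  obtain ⟨b, hb⟩ := h2 a
  obtain ⟨e, -, he⟩ := isQuasiregular_iff.1 (isQuasiregular_of_norm_lt_one (hΨK Ψ h1 h3))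
  -- From `Ψ • a = b (1 + a)` follows `1 + (a - Ψ • a) = (1 - b)(1 + a)`. The left side has inverse
  -- `1 + e` because `a - Ψ • a` is small, so `(1 + e)(1 - b)` is a left inverse of `1 + a`.
  refine ⟨e - b - e * b, ?_⟩
  rw [hb] at he
  rw [← he]
  noncomm_ring

/-- If `1 + b` is a left inverse of `1 + a` and has a left inverse `1 + c` itself, then `1 + c = 1 +
a`. This upgrades the one-sided inverses produced by gluing. -/
theorem isQuasiregular_of_left_left {B : Type*} [NonUnitalRing B] {a b c : B}
    (h : b + a + b * a = 0) (h' : c + b + c * b = 0) : IsQuasiregular a := by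
  have e : c = a := by
    have e1 : c + (b + a + b * a) + c * (b + a + b * a) =
        (c + b + c * b) + a + (c + b + c * b) * a := by noncomm_ring
    simpa [h, h'] using e1
  subst e
  refine isQuasiregular_iff.2 ⟨b, ?_, ?_⟩
  · rw [← h']; abel
  · rw [← h]; abel

variable (X) in
theorem isQuasiregular_iff_fibre [LocallyCompactSpace X] [T2Space X] [CompleteSpace A] (a : A) :
    IsQuasiregular a ↔ ∀ x : X, IsQuasiregular (fibreMk X A x a) := by
  constructor
  · intro h x
    obtain ⟨b, h1, h2⟩ := isQuasiregular_iff.1 h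
    refine isQuasiregular_iff.2 ⟨fibreMk X A x b, ?_, ?_⟩
    · rw [← fibreMk_mul, ← map_add, ← map_add, h1, map_zero]
    · rw [← fibreMk_mul, ← map_add, ← map_add, h2, map_zero]
  · intro h
    have key : ∀ x : X, ∃ y : Fibre X A x, y + fibreMk X A x a + fibreMk X A x a * y = 0 ∧
        fibreMk X A x a + y + y * fibreMk X A x a = 0 := fun x => isQuasiregular_iff.1 (h x)
    obtain ⟨b, hb⟩ := exists_left_quasiInverse (X := X) a fun x => by
      obtain ⟨y, -, hy⟩ := key x
      obtain ⟨b, rfl⟩ := fibreMk_surjective X A x y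
      refine ⟨b, ?_⟩
      rw [map_add, map_add, fibreMk_mul, ← hy]
      abel
    -- In each fibre `b_x` must be the two-sided quasi-inverse of `a_x`, so `a` itself lifts a left
    -- quasi-inverse of `b_x`.
    obtain ⟨c, hc⟩ := exists_left_quasiInverse (X := X) b fun x => by
      obtain ⟨y, hy, -⟩ := key x
      refine ⟨a, ?_⟩
      have hbx := congrArg (fibreMk X A x) hb
      rw [map_add, map_add, fibreMk_mul, map_zero] at hbx
      rw [map_add, map_add, fibreMk_mul]
      have e : fibreMk X A x b = y := by
        have e1 : fibreMk X A x b + (y + fibreMk X A x a + fibreMk X A x a * y) +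
            fibreMk X A x b * (y + fibreMk X A x a + fibreMk X A x a * y) =
            (fibreMk X A x b + fibreMk X A x a + fibreMk X A x b * fibreMk X A x a) + y +
            (fibreMk X A x b + fibreMk X A x a + fibreMk X A x b * fibreMk X A x a) * y := by
          noncomm_ring
        simpa [hy, hbx] using e1
      rw [e, ← hy]
      abel
    exact isQuasiregular_of_left_left hb hc

end Local

/-! ### Density in the Gelfand transform by gluing -/

section Dense

variable {X A B : Type*} [TopologicalSpace X] [LocallyCompactSpace X] [T2Space X]
  [NonUnitalNormedRing A] [NormedSpace ℂ A] [IsScalarTower ℂ A A] [SMulCommClass ℂ A A]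
  [C0BanachAlgebra X A]
  [NonUnitalNormedRing B] [NormedSpace ℂ B] [IsScalarTower ℂ B B] [SMulCommClass ℂ B B]
  [C0BanachAlgebra X B]

/-- If all fibre maps of `φ : A → B` have dense range, then the image of `A` in the Gelfand
transform of `B` is dense. -/
theorem denseRange_gelfandHom_comp (φ : ContractiveHom X A B)
    (h : ∀ x, DenseRange (φ.fibreMap x)) :
    DenseRange ((gelfandHom X B).toNonUnitalAlgHom.comp φ.toNonUnitalAlgHom) := by
  refine Metric.dense_iff.2 fun ξ ε hε => ?_
  set ε' := ε / 4 with hε'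
  have hε0 : 0 < ε' := by positivity
  obtain ⟨K, hK, hK'⟩ := Filter.mem_cocompact.1 (ξ.2.2.eventually (gt_mem_nhds hε0))
  -- Weighting the error by `Ψ v` makes the bound stable under `χ + (1 - χ) ψ`. The factor `2`
  -- covers the approximation of `ξ` by some `b`, and of `b` by the image of `φ`.
  obtain ⟨Ψ, h1, ⟨a, ha⟩, h3⟩ : ∃ Ψ : C₀(X, ℂ), IsCutoff Ψ ∧
      (∃ a : A, ∀ v, ‖Ψ v • ξ.1 v - fibreMk X B v (φ.toNonUnitalAlgHom a)‖ ≤ ‖Ψ v‖ * (2 * ε')) ∧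
      ∀ v ∈ K, Ψ v = 1 := by
    refine IsCompact.induction_on hK
      (p := fun s => ∃ Ψ : C₀(X, ℂ), IsCutoff Ψ ∧
      (∃ a : A, ∀ v, ‖Ψ v • ξ.1 v - fibreMk X B v (φ.toNonUnitalAlgHom a)‖ ≤ ‖Ψ v‖ * (2 * ε')) ∧
      ∀ v ∈ s, Ψ v = 1) ?_ ?_ ?_ ?_
    · exact ⟨0, IsCutoff.zero, ⟨0, by simp⟩, by simp⟩
    · rintro s t hst ⟨Ψ, h1, h2, h3⟩
      exact ⟨Ψ, h1, h2, fun v hv => h3 v (hst hv)⟩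
    · rintro s t ⟨χ, h1, ⟨a, h2⟩, h3⟩ ⟨ψ, h1', ⟨b, h2'⟩, h3'⟩
      refine ⟨_, h1.union h1', ⟨a + (b - χ • b), fun v => ?_⟩, ?_⟩
      · have hχb : φ.toNonUnitalAlgHom (χ • b) = χ • φ.toNonUnitalAlgHom b := φ.map_C0_smul' χ b
        obtain ⟨t, ht, e⟩ := h1 v
        obtain ⟨s, hs, e'⟩ := h1' v
        have hn : ‖(χ + (ψ - χ * ψ)) v‖ = t + (1 - t) * s := by
          have : (χ + (ψ - χ * ψ)) v = ((t + (1 - t) * s : ℝ) : ℂ) := by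
            simp [e, e']; ring
          rw [this, Complex.norm_real, Real.norm_of_nonneg]
          have := mul_nonneg (sub_nonneg.2 ht.2) hs.1
          linarith [ht.1]
        have h2v := h2 v
        have h2v' := h2' v
        rw [e, Complex.norm_real, Real.norm_of_nonneg ht.1] at h2v
        rw [e', Complex.norm_real, Real.norm_of_nonneg hs.1] at h2v'
        have ed : (χ + (ψ - χ * ψ)) v • ξ.1 v -
            fibreMk X B v (φ.toNonUnitalAlgHom (a + (b - χ • b))) =
            ((t : ℂ) • ξ.1 v - fibreMk X B v (φ.toNonUnitalAlgHom a)) +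
            ((1 - t : ℝ) : ℂ) • ((s : ℂ) • ξ.1 v - fibreMk X B v (φ.toNonUnitalAlgHom b)) := by
          simp only [map_add, map_sub, hχb, fibreMk_smul, ZeroAtInftyContinuousMap.add_apply,
            ZeroAtInftyContinuousMap.sub_apply, ZeroAtInftyContinuousMap.mul_apply, e, e']
          push_cast
          module
        rw [ed, hn]
        refine (norm_add_le _ _).trans ?_
        rw [norm_smul, Complex.norm_real, Real.norm_of_nonneg (sub_nonneg.2 ht.2)]
        have := mul_le_mul_of_nonneg_left h2v' (sub_nonneg.2 ht.2)
        linarith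
      · rintro v (hv | hv)
        · simp [h3 v hv]
        · simp [h3' v hv]
    · intro x _
      obtain ⟨b, hb⟩ := ξ.2.1 x ε' hε0
      obtain ⟨p, hp⟩ := (h x).exists_dist_lt (fibreMk X B x b) hε0
      obtain ⟨a, rfl⟩ := fibreMk_surjective X A x p
      rw [dist_eq_norm, φ.fibreMap_mk, ← map_sub] at hp
      have hab := eventually_norm_fibreMk_lt hp
      obtain ⟨χ, h1, h2, h3⟩ := exists_cutoff_nhds (hb.and hab)
      refine ⟨_, mem_nhdsWithin_of_mem_nhds h2, χ, h1, ⟨χ • a, fun v => ?_⟩, fun v hv => hv⟩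
      have hχa : φ.toNonUnitalAlgHom (χ • a) = χ • φ.toNonUnitalAlgHom a := φ.map_C0_smul' χ a
      rw [hχa, fibreMk_smul, ← smul_sub, norm_smul]
      by_cases hv : ‖ξ.1 v - fibreMk X B v b‖ ≤ ε' ∧
          ‖fibreMk X B v (b - φ.toNonUnitalAlgHom a)‖ < ε'
      · gcongr
        have := norm_add_le (ξ.1 v - fibreMk X B v b)
          (fibreMk X B v (b - φ.toNonUnitalAlgHom a))
        rw [map_sub, sub_add_sub_cancel, ← map_sub] at this
        linarith [hv.1, hv.2]
      · rw [h3 v hv, norm_zero, zero_mul, zero_mul]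
  refine ⟨_, ?_, a, rfl⟩
  rw [Metric.mem_ball, dist_comm, dist_eq_norm]
  refine lt_of_le_of_lt (Gelfand.norm_le (C := 3 * ε') (by positivity) fun v => ?_)
    (by rw [hε']; linarith)
  change ‖ξ.1 v - fibreMk X B v (φ.toNonUnitalAlgHom a)‖ ≤ 3 * ε'
  have hav := ha v
  by_cases hv : v ∈ K
  · rw [h3 v hv, one_smul, norm_one, one_mul] at hav
    linarith
  · obtain ⟨t, ht, e⟩ := h1 v
    have hξ : ‖ξ.1 v‖ < ε' := hK' hv
    rw [e, Complex.norm_real, Real.norm_of_nonneg ht.1] at hav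
    have ed : ξ.1 v - fibreMk X B v (φ.toNonUnitalAlgHom a) = ((1 - t : ℝ) : ℂ) • ξ.1 v +
        ((t : ℂ) • ξ.1 v - fibreMk X B v (φ.toNonUnitalAlgHom a)) := by
      push_cast
      module
    rw [ed]
    refine (norm_add_le _ _).trans ?_
    rw [norm_smul, Complex.norm_real, Real.norm_of_nonneg (sub_nonneg.2 ht.2)]
    have h5 := mul_le_mul_of_nonneg_left hξ.le (sub_nonneg.2 ht.2)
    nlinarith [ht.1, ht.2]

end Dense

/-! ### Spectral radii and isoradiality -/

section Isoradial

variable {X A B : Type*} [TopologicalSpace X] [LocallyCompactSpace X] [T2Space X]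
  [NonUnitalNormedRing A] [NormedSpace ℂ A] [IsScalarTower ℂ A A] [SMulCommClass ℂ A A]
  [CompleteSpace A] [C0BanachAlgebra X A]
  [NonUnitalNormedRing B] [NormedSpace ℂ B] [IsScalarTower ℂ B B] [SMulCommClass ℂ B B]
  [CompleteSpace B] [C0BanachAlgebra X B]

variable (X) in
/-- The spectral radius of `a` is the supremum of the spectral radii of the `a_x`. -/
theorem banachSpectralRadius_eq_iSup (a : A) :
    banachSpectralRadius a = ⨆ x : X, banachSpectralRadius (fibreMk X A x a) := by
  refine eq_of_forall_ge_iff fun r => ?_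
  rw [iSup_le_iff]
  simp only [banachSpectralRadius_le_iff]
  rw [forall_comm]
  refine forall_congr' fun z => ?_
  rw [isQuasiregular_iff_fibre X, not_forall, forall_exists_index]
  simp only [Units.smul_def, map_neg, map_smul]

theorem isIsoradial_of_fibre (φ : ContractiveHom X A B) (h : ∀ x, IsIsoradial (φ.fibreMap x)) :
    IsIsoradial φ.toNonUnitalAlgHom where
  norm_map_le := φ.norm_map_le'
  radius_map a := by
    rw [banachSpectralRadius_eq_iSup X, banachSpectralRadius_eq_iSup X a]
    refine iSup_congr fun x => ?_
    rw [← φ.fibreMap_mk]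
    exact (h x).radius_map _

variable (X A) in
-- A quasi-inverse of `ι(a)` is a section, and its value at `x` is a quasi-inverse of `a_x`. The
-- fibre criterion for `A` then applies, without identifying the fibres of the Gelfand transform.
theorem isIsoradial_gelfandHom : IsIsoradial (gelfandHom X A).toNonUnitalAlgHom where
  norm_map_le := (gelfandHom X A).norm_map_le'
  radius_map a := by
    refine eq_of_forall_ge_iff fun r => ?_
    simp only [banachSpectralRadius_le_iff]
    refine forall_congr' fun z => ?_
    have e : -(z⁻¹ • (gelfandHom X A).toNonUnitalAlgHom a) =
        (gelfandHom X A).toNonUnitalAlgHom (-(z⁻¹ • a)) := by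
      simp only [Units.smul_def, map_neg, map_smul]
    rw [e]
    refine imp_congr_left (not_congr ⟨fun h => ?_, fun h => h.map _⟩)
    refine (isQuasiregular_iff_fibre X _).2 fun x => ?_
    obtain ⟨η, h1, h2⟩ := isQuasiregular_iff.1 h
    exact isQuasiregular_iff.2 ⟨η.1 x, congrArg (fun ζ : Gelfand X A => ζ.1 x) h1,
      congrArg (fun ζ : Gelfand X A => ζ.1 x) h2⟩

variable (X A) in
theorem isFull_gelfandHom : IsFull (gelfandHom X A).toNonUnitalAlgHom where
  toIsIsoradial := isIsoradial_gelfandHom X A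
  denseRange := by
    let φ : ContractiveHom X A A :=
      { NonUnitalAlgHom.id ℂ A with
        map_C0_smul' := fun _ _ => rfl
        norm_map_le' := fun _ => le_rfl }
    -- The density result is applied to the identity of `A`, whose fibre maps are surjective.
    refine denseRange_gelfandHom_comp φ fun x => Function.Surjective.denseRange fun p => ?_
    obtain ⟨a, rfl⟩ := fibreMk_surjective X A x p
    exact ⟨fibreMk X A x a, rfl⟩

end Isoradial

end C0BanachAlgebra

/-! ### Dense, inverse-closed homomorphisms of Banach algebras -/

/-! ### The equation `w - w² = c` solved by a power series -/

section CatalanSum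

variable {T : Type*} [NormedRing T]

/-- The solution `w = ∑ₖ Cₖ cᵏ⁺¹` of `w - w² = c`, where `Cₖ` are the Catalan numbers. -/
noncomputable def catalanSum (c : T) : T := ∑' k : ℕ, catalan k • c ^ (k + 1)

theorem catalan_le_four_pow (k : ℕ) : catalan k ≤ 4 ^ k := by
  rw [catalan_eq_centralBinom_div]
  exact (Nat.div_le_self _ _).trans (Nat.centralBinom_le_four_pow k)

theorem norm_catalan_smul_le (c : T) (k : ℕ) :
    ‖catalan k • c ^ (k + 1)‖ ≤ 4 ^ k * ‖c ^ (k + 1)‖ := by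
  refine (norm_nsmul_le).trans ?_
  gcongr
  exact_mod_cast catalan_le_four_pow k

theorem norm_catalanSum_le {c : T} (hc : ‖c‖ ≤ 1 / 8) : ‖catalanSum c‖ ≤ 2 * ‖c‖ := by
  have h := hasSum_geometric_two.mul_left ‖c‖
  rw [mul_comm] at h
  refine tsum_of_norm_bounded h fun k => (norm_catalan_smul_le c k).trans ?_
  have h1 : ‖c ^ (k + 1)‖ ≤ ‖c‖ ^ (k + 1) := norm_pow_le' c k.succ_pos
  -- The threshold `1 / 8` turns the Catalan growth `4 ^ k` into the geometric series of ratio `1 /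
  -- 2`.
  calc (4 : ℝ) ^ k * ‖c ^ (k + 1)‖ ≤ 4 ^ k * (‖c‖ * (1 / 8) ^ k) := by
        gcongr
        refine h1.trans ?_
        rw [pow_succ']
        gcongr
    _ = ‖c‖ * (1 / 2) ^ k := by
        rw [mul_left_comm, ← mul_pow]
        norm_num

variable [NormedAlgebra ℂ T] [CompleteSpace T]

/-- Gelfand's formula gives `‖c ^ n‖ ≤ r ^ n` eventually, with `4 r < 1`. Only the spectral radius
is bounded, because in the application smallness of norm is known only for the image of `c`. -/
theorem summable_norm_catalan {c : T} (h : spectralRadius ℂ c < 1 / 4) :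
    Summable fun k : ℕ => ‖catalan k • c ^ (k + 1)‖ := by
  obtain ⟨r, hr, hr4⟩ := ENNReal.lt_iff_exists_nnreal_btwn.1 h
  have hr4' : (r : ℝ) < 1 / 4 := by
    have : r < 1 / 4 := by
      rw [← ENNReal.coe_lt_coe]
      simpa using hr4
    exact_mod_cast this
  have hev : ∀ᶠ n : ℕ in Filter.atTop, ‖c ^ n‖ ≤ (r : ℝ) ^ n := by
    filter_upwards [(spectrum.pow_nnnorm_pow_one_div_tendsto_nhds_spectralRadius c).eventually
      (gt_mem_nhds hr), Filter.eventually_gt_atTop 0] with n hn hn0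
    have h1 : (‖c ^ n‖₊ : ℝ≥0∞) ≤ (r : ℝ≥0∞) ^ n := by
      have h2 := ENNReal.rpow_le_rpow hn.le (Nat.cast_nonneg n : (0 : ℝ) ≤ n)
      rwa [← ENNReal.rpow_mul, one_div, inv_mul_cancel₀ (by exact_mod_cast hn0.ne'),
        ENNReal.rpow_one, ENNReal.rpow_natCast] at h2
    exact_mod_cast h1
  have hs : Summable fun k : ℕ => (r : ℝ) * (4 * r) ^ k :=
    (summable_geometric_of_lt_one (by positivity) (by linarith)).mul_left _
  refine Summable.of_norm_bounded_eventually_nat hs ?_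
  filter_upwards [(Filter.tendsto_add_atTop_nat 1).eventually hev] with k hk
  rw [norm_norm]
  refine (norm_catalan_smul_le c k).trans ?_
  calc (4 : ℝ) ^ k * ‖c ^ (k + 1)‖ ≤ 4 ^ k * (r : ℝ) ^ (k + 1) := by gcongr
    _ = r * (4 * r) ^ k := by rw [mul_pow, pow_succ]; ring

/-- The Catalan convolution recurrence says that the Cauchy product of the series with itself is the
series without its first term `c`. -/
theorem catalanSum_sub_sq {c : T} (h : spectralRadius ℂ c < 1 / 4) :
    catalanSum c - catalanSum c * catalanSum c = c := by
  have hs := summable_norm_catalan h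
  have e1 : catalanSum c = c + ∑' k : ℕ, catalan (k + 1) • c ^ (k + 2) := by
    rw [catalanSum, hs.of_norm.tsum_eq_zero_add]
    simp [add_assoc, one_add_one_eq_two]
  have e2 : catalanSum c * catalanSum c = ∑' k : ℕ, catalan (k + 1) • c ^ (k + 2) := by
    rw [catalanSum, tsum_mul_tsum_eq_tsum_sum_antidiagonal_of_summable_norm hs hs]
    refine tsum_congr fun n => ?_
    rw [catalan_succ', Finset.sum_smul]
    refine Finset.sum_congr rfl fun ij hij => ?_
    rw [smul_mul_smul_comm, ← pow_add, ← Finset.HasAntidiagonal.mem_antidiagonal.1 hij]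
    congr 2
    ring
  rw [e2, sub_eq_iff_eq_add]
  exact e1

theorem Commute.catalanSum_right {a c : T} (h : Commute a c) (hc : spectralRadius ℂ c < 1 / 4) :
    Commute a (catalanSum c) := by
  have hs := (summable_norm_catalan hc).of_norm
  unfold Commute SemiconjBy catalanSum
  rw [← hs.tsum_mul_left, ← hs.tsum_mul_right]
  exact tsum_congr fun k => ((h.pow_right (k + 1)).smul_right _)

theorem map_catalanSum {U : Type*} [NormedRing U] (f : T →+* U) (hf : Continuous f) {c : T}
    (hc : spectralRadius ℂ c < 1 / 4) : f (catalanSum c) = catalanSum (f c) := by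
  have hs := (summable_norm_catalan hc).of_norm
  rw [catalanSum, hs.map_tsum f hf, catalanSum]
  exact tsum_congr fun k => by simp

end CatalanSum

/-! ### Lifting idempotents and comparing components of unit groups -/

section DenseInverseClosed

variable {T U : Type*} [NormedRing T] [NormedRing U]

/-- A homomorphism with dense range that reflects invertibility near `1` reflects invertibility. -/
theorem isLocalHom_of_nhds_one {T U : Type*} [Ring T] [Ring U] [TopologicalSpace U]
    [IsTopologicalRing U] (f : T →+* U) (hd : DenseRange f) {O : Set U} (hO : O ∈ 𝓝 (1 : U))
    (h : ∀ x, f x ∈ O → IsUnit x) : IsLocalHom f where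
  map_nonunit x hx := by
    obtain ⟨u, hu⟩ := hx
    have h1 : ∀ᶠ y in 𝓝 (↑u⁻¹ : U), f x * y ∈ O ∧ y * f x ∈ O := by
      have c1 : Filter.Tendsto (fun y => f x * y) (𝓝 (↑u⁻¹ : U)) (𝓝 1) := by
        have : Continuous fun y => f x * y := by fun_prop
        simpa [← hu] using this.tendsto (↑u⁻¹ : U)
      have c2 : Filter.Tendsto (fun y => y * f x) (𝓝 (↑u⁻¹ : U)) (𝓝 1) := by
        have : Continuous fun y => y * f x := by fun_prop
        simpa [← hu] using this.tendsto (↑u⁻¹ : U)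
      exact (c1.eventually hO).and (c2.eventually hO)
    obtain ⟨_, ⟨hy1, hy2⟩, y, rfl⟩ := mem_closure_iff_nhds.1 (hd (↑u⁻¹ : U)) _ h1
    rw [← map_mul] at hy1 hy2
    obtain ⟨v, hv⟩ := h _ hy1
    obtain ⟨w, hw⟩ := h _ hy2
    refine isUnit_iff_exists_and_exists.2 ⟨⟨y * ↑v⁻¹, ?_⟩, ⟨↑w⁻¹ * y, ?_⟩⟩
    · rw [← mul_assoc, ← hv, Units.mul_inv]
    · rw [mul_assoc, ← hw, Units.inv_mul]

theorem IsLocalHom.spectralRadius_map {T U : Type*} [Ring T] [Algebra ℂ T] [Ring U] [Algebra ℂ U]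
    (f : T →ₐ[ℂ] U) [IsLocalHom f] (c : T) : spectralRadius ℂ (f c) = spectralRadius ℂ c := by
  have : spectrum ℂ (f c) = spectrum ℂ c := by
    ext z
    rw [spectrum.mem_iff, spectrum.mem_iff, ← f.commutes, ← map_sub, isUnit_map_iff f]
  rw [spectralRadius, spectralRadius, this]

/-- The factor `‖1‖` is kept since `‖1‖ = 1` is not assumed; the result is later used for matrix
algebras. -/
theorem spectralRadius_le_norm_mul_norm_one [NormedAlgebra ℂ U] [CompleteSpace U] (c : U) :
    spectralRadius ℂ c ≤ ENNReal.ofReal (‖c‖ * ‖(1 : U)‖) := by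
  refine iSup₂_le fun z hz => ?_
  rw [← enorm_eq_nnnorm, ← ofReal_norm]
  exact ENNReal.ofReal_le_ofReal (spectrum.norm_le_norm_mul_of_mem hz)

variable [NormedAlgebra ℂ T] [NormedAlgebra ℂ U] [CompleteSpace T] [CompleteSpace U]

theorem tendsto_catalanSum_idem {p : U} (hp : p * p = p) :
    Filter.Tendsto (fun b => catalanSum (b - b * b)) (𝓝 p) (𝓝 0) := by
  have hc : Filter.Tendsto (fun b : U => ‖b - b * b‖) (𝓝 p) (𝓝 0) := by
    have : Continuous fun b : U => ‖b - b * b‖ := by fun_prop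
    simpa [hp] using this.tendsto p
  refine squeeze_zero_norm' ?_ (by simpa using hc.const_mul 2)
  filter_upwards [hc.eventually (gt_mem_nhds (by norm_num : (0 : ℝ) < 1 / 8))] with b hb
  exact norm_catalanSum_le hb.le

/-- Idempotents in `U` are limits of images of idempotents in `T`. -/
theorem exists_idem_map_mem (f : T →ₐ[ℂ] U) (hf : Continuous f) (hd : DenseRange f) [IsLocalHom f]
    {p : U} (hp : p * p = p) {O : Set U} (hO : O ∈ 𝓝 p) : ∃ e : T, e * e = e ∧ f e ∈ O := by
  have hW := tendsto_catalanSum_idem hp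
  have hV : Filter.Tendsto (fun b : U => 1 - 2 * catalanSum (b - b * b)) (𝓝 p)
      (𝓝 ((1 : Uˣ) : U)) := by
    simpa using (hW.const_mul 2).const_sub 1
  -- With `w - w² = b - b²` and `w` commuting with `b`, one has `(b - w)(b + w - 1) = 0`, that is
  -- `(b - w)² = (b - w)(1 - 2w)`. So `(b - w)(1 - 2w)⁻¹` is idempotent, and it tends to `p` because
  -- `w` tends to `0`.
  have hg : Filter.Tendsto (fun b : U => (b - catalanSum (b - b * b)) *
      Ring.inverse (1 - 2 * catalanSum (b - b * b))) (𝓝 p) (𝓝 p) := by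
    have h1 := (NormedRing.inverse_continuousAt (1 : Uˣ)).tendsto.comp hV
    have h2 := (Filter.tendsto_id (x := 𝓝 p)).sub hW
    simpa using h2.mul h1
  have hc : Filter.Tendsto (fun b : U => ‖b - b * b‖ * ‖(1 : U)‖) (𝓝 p) (𝓝 0) := by
    have : Continuous fun b : U => ‖b - b * b‖ * ‖(1 : U)‖ := by fun_prop
    simpa [hp] using this.tendsto p
  have hev : ∀ᶠ b in 𝓝 p, ((b - catalanSum (b - b * b)) *
      Ring.inverse (1 - 2 * catalanSum (b - b * b)) ∈ O ∧
      IsUnit (1 - 2 * catalanSum (b - b * b))) ∧ ‖b - b * b‖ * ‖(1 : U)‖ < 1 / 4 :=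
    ((hg.eventually hO).and (hV.eventually (Units.nhds 1))).and
      (hc.eventually (gt_mem_nhds (by norm_num)))
  obtain ⟨_, ⟨⟨h1, h2⟩, h3⟩, a, rfl⟩ := mem_closure_iff_nhds.1 (hd p) _ hev
  -- The norm estimate lives in `U`; the spectral radius transfers it to `T`, since `f` reflects
  -- invertibility.
  have hr : spectralRadius ℂ (a - a * a) < 1 / 4 := by
    rw [← IsLocalHom.spectralRadius_map f]
    refine (spectralRadius_le_norm_mul_norm_one _).trans_lt ?_
    rw [map_sub, map_mul]
    calc _ < ENNReal.ofReal (1 / 4) := (ENNReal.ofReal_lt_ofReal_iff (by norm_num)).2 h3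
      _ = 1 / 4 := by
        rw [ENNReal.ofReal_div_of_pos (by norm_num)]
        simp
  set w := catalanSum (a - a * a) with hw
  have hfw : f w = catalanSum (f a - f a * f a) := by
    have := map_catalanSum (f : T →+* U) hf hr
    simpa using this
  have haw : Commute a w :=
    (((Commute.refl a).sub_right ((Commute.refl a).mul_right (Commute.refl a)))).catalanSum_right hr
  have hww : w - w * w = a - a * a := catalanSum_sub_sq hr
  rw [← hfw] at h1 h2
  have hu : IsUnit (1 - 2 * w) := by
    rw [← isUnit_map_iff f]
    simpa [map_ofNat f 2] using h2
  obtain ⟨u, hu⟩ := hu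
  have hcomm : Commute (a - w) (u : T) := by
    have h2w : ∀ b : T, Commute b w → Commute b (1 - 2 * w) := fun b hb =>
      (Commute.one_right b).sub_right ((Commute.ofNat_right b 2).mul_right hb)
    rw [hu]
    exact h2w _ (haw.sub_left (Commute.refl w))
  have hsq : (a - w) * (a - w) = (a - w) * u := by
    rw [hu, ← sub_eq_zero]
    have : (a - w) * (a - w) - (a - w) * (1 - 2 * w) =
        (w - w * w) - (a - a * a) + (a * w - w * a) := by noncomm_ring
    rw [this, hww, haw.eq]
    simp
  refine ⟨(a - w) * ↑u⁻¹, ?_, ?_⟩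
  · calc (a - w) * ↑u⁻¹ * ((a - w) * ↑u⁻¹) = (a - w) * (↑u⁻¹ * (a - w)) * ↑u⁻¹ := by noncomm_ring
      _ = (a - w) * (a - w) * ↑u⁻¹ * ↑u⁻¹ := by
          rw [← hcomm.units_inv_right.eq]; noncomm_ring
      _ = (a - w) * ↑u⁻¹ := by rw [hsq, mul_assoc _ (u : T), Units.mul_inv, mul_one]
  · have e : f (↑u⁻¹ : T) = Ring.inverse (1 - 2 * f w) := by
      have : (1 - 2 * f w : U) = ((Units.map (f : T →* U) u : Uˣ) : U) := by
        change _ = f u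
        rw [hu]
        simp [map_ofNat f 2]
      rw [this, Ring.inverse_unit, ← map_inv]
      rfl
    rw [map_mul, map_sub, e]
    exact h1

theorem mem_connectedComponent_one_of_segment {u : Tˣ}
    (h : ∀ t : unitInterval, IsUnit (1 + ((t : ℝ) : ℂ) • ((u : T) - 1))) :
    u ∈ connectedComponent (1 : Tˣ) := by
  have hc : Continuous fun t : unitInterval => (h t).unit := by
    rw [Units.isOpenEmbedding_val.isInducing.continuous_iff]
    change Continuous fun t : unitInterval => 1 + ((t : ℝ) : ℂ) • ((u : T) - 1)
    fun_prop
  have h0 : (h 0).unit = 1 := Units.ext (by simp)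
  have h1 : (h 1).unit = u := Units.ext (by simp)
  refine (isPreconnected_range hc).subset_connectedComponent ⟨0, h0⟩ ⟨1, h1⟩

theorem isUnit_segment {u : U} (hu : ‖u - 1‖ < 1) (t : unitInterval) :
    IsUnit (1 + ((t : ℝ) : ℂ) • (u - 1)) := by
  rw [← sub_neg_eq_add]
  refine isUnit_one_sub_of_norm_lt_one ?_
  rw [norm_neg, norm_smul, Complex.norm_real, Real.norm_of_nonneg t.2.1]
  exact (mul_le_of_le_one_left (norm_nonneg _) t.2.2).trans_lt hu

theorem isOpen_units_near_one : IsOpen {u : Uˣ | ‖(u : U) - 1‖ < 1} :=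
  isOpen_lt (by fun_prop) continuous_const

theorem isOpen_connectedComponentOfOne_units :
    IsOpen (Subgroup.connectedComponentOfOne Uˣ : Set Uˣ) := by
  refine Subgroup.isOpen_of_mem_nhds _ (g := 1) ?_
  refine Filter.mem_of_superset (isOpen_units_near_one.mem_nhds (by simp)) fun u hu => ?_
  exact mem_connectedComponent_one_of_segment (isUnit_segment hu)

theorem denseRange_units_map (f : T →ₐ[ℂ] U) (hd : DenseRange f) [IsLocalHom f] :
    DenseRange (Units.map (f : T →* U)) := by
  refine dense_iff_inter_open.2 fun O hO ⟨v, hv⟩ => ?_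
  obtain ⟨_, ⟨w, hw, hwx⟩, x, rfl⟩ :=
    dense_iff_inter_open.1 hd _ (Units.isOpenMap_val _ hO) ⟨_, v, hv, rfl⟩
  have hx : IsUnit x := by
    rw [← isUnit_map_iff f, ← hwx]
    exact w.isUnit
  have e : Units.map (f : T →* U) hx.unit = w := Units.ext hwx.symm
  exact ⟨w, hw, hx.unit, e⟩

/-- The segment from `1` to `u` may leave every small ball of `T`, but its image stays in the unit
ball about `1`, and `f` reflects invertibility along it. -/
theorem mem_connectedComponent_of_map_near_one (f : T →ₐ[ℂ] U) [IsLocalHom f] {u : Tˣ}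
    (hu : ‖f u - 1‖ < 1) : u ∈ Subgroup.connectedComponentOfOne Tˣ := by
  refine mem_connectedComponent_one_of_segment fun t => ?_
  rw [← isUnit_map_iff f]
  rw [map_add, map_smul, map_sub, map_one]
  exact isUnit_segment hu t

theorem exists_inv_mul_map_mem_connectedComponent (f : T →ₐ[ℂ] U) (hd : DenseRange f)
    [IsLocalHom f] (v : Uˣ) :
    ∃ u : Tˣ, v⁻¹ * Units.map (f : T →* U) u ∈ Subgroup.connectedComponentOfOne Uˣ := by
  have ho : IsOpen {w : Uˣ | v⁻¹ * w ∈ Subgroup.connectedComponentOfOne Uˣ} :=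
    isOpen_connectedComponentOfOne_units.preimage (continuous_const_mul v⁻¹)
  obtain ⟨_, hw, u, rfl⟩ := dense_iff_inter_open.1 (denseRange_units_map f hd) _ ho
    ⟨v, by simp [one_mem]⟩
  exact ⟨u, hw⟩

/-- Let `D` be the closure of the image of the identity component of `Tˣ`. By density it contains a
neighbourhood of `1`, so it is an open and closed subgroup containing the identity component of
`Uˣ`. Hence the image of `u` is close to that of some `v` in the component, and `u * v⁻¹` is joined
to `1` by a segment. No path has to be lifted. -/
theorem mem_connectedComponent_of_map_mem (f : T →ₐ[ℂ] U) (hd : DenseRange f)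
    [IsLocalHom f] {u : Tˣ}
    (hu : Units.map (f : T →* U) u ∈ Subgroup.connectedComponentOfOne Uˣ) :
    u ∈ Subgroup.connectedComponentOfOne Tˣ := by
  set F := Units.map (f : T →* U) with hF
  set D := ((Subgroup.connectedComponentOfOne Tˣ).map F).topologicalClosure with hD
  have hW : {w : Uˣ | ‖(w : U) - 1‖ < 1} ⊆ D := by
    refine ((denseRange_units_map f hd).open_subset_closure_inter isOpen_units_near_one).trans ?_
    refine closure_mono ?_
    rintro _ ⟨hw, x, rfl⟩
    exact ⟨x, mem_connectedComponent_of_map_near_one f hw, rfl⟩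
  have hDo : IsOpen (D : Set Uˣ) := Subgroup.isOpen_of_mem_nhds D (g := 1)
    (Filter.mem_of_superset (isOpen_units_near_one.mem_nhds (by simp)) hW)
  have hDc : IsClosed (D : Set Uˣ) := Subgroup.isClosed_topologicalClosure _
  have huD : F u ∈ D := IsClopen.connectedComponent_subset ⟨hDc, hDo⟩ (one_mem D) hu
  have hn : {w : Uˣ | ‖((F u * w⁻¹ : Uˣ) : U) - 1‖ < 1} ∈ 𝓝 (F u) := by
    have ho : IsOpen {w : Uˣ | ‖((F u * w⁻¹ : Uˣ) : U) - 1‖ < 1} :=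
      isOpen_units_near_one.preimage (by fun_prop : Continuous fun w : Uˣ => F u * w⁻¹)
    exact ho.mem_nhds (by simp)
  obtain ⟨_, hw, v, hv, rfl⟩ := mem_closure_iff_nhds.1 huD _ hn
  have huv : u * v⁻¹ ∈ Subgroup.connectedComponentOfOne Tˣ := by
    refine mem_connectedComponent_of_map_near_one f ?_
    have hw' : ‖((F u * (F v)⁻¹ : Uˣ) : U) - 1‖ < 1 := hw
    rw [← map_inv, ← map_mul] at hw'
    exact hw'
  simpa using mul_mem huv hv

end DenseInverseClosed

/-! ### Matrices over Banach algebras -/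

section MatrixTopology

variable {S : Type*} [NormedRing S] [CompleteSpace S] {ι κ : Type*} [Fintype ι] [DecidableEq ι]
  [Fintype κ] [DecidableEq κ]

/-- Matrices over a Banach algebra form a complete space in the `ℓ^∞` operator norm. -/
theorem completeSpace_linftyOp : @CompleteSpace (Matrix ι ι S)
    (Matrix.linftyOpNormedRing (α := S) (n := ι)).toPseudoMetricSpace.toUniformSpace :=
  inferInstanceAs (CompleteSpace (Matrix ι ι S))

/-- The statement concerns the entrywise topology; the `ℓ^∞` operator norm inducing it enters only
as an explicit instance in the proof. -/
theorem isUnit_mem_nhds_one : {M : Matrix ι ι S | IsUnit M} ∈ 𝓝 (1 : Matrix ι ι S) :=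
  @Units.nhds (Matrix ι ι S) Matrix.linftyOpNormedRing
    (@instHasSummableGeomSeriesOfCompleteSpace _ Matrix.linftyOpNormedRing
      completeSpace_linftyOp) 1

theorem tendsto_ringInverse_one :
    Filter.Tendsto Ring.inverse (𝓝 (1 : Matrix ι ι S)) (𝓝 (1 : Matrix ι ι S)) := by
  have h : Filter.Tendsto Ring.inverse (𝓝 (1 : Matrix ι ι S))
      (𝓝 (Ring.inverse (1 : Matrix ι ι S))) :=
    @NormedRing.inverse_continuousAt (Matrix ι ι S) Matrix.linftyOpNormedRing
      (@instHasSummableGeomSeriesOfCompleteSpace _ Matrix.linftyOpNormedRing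
      completeSpace_linftyOp) 1
  rwa [Ring.inverse_one] at h

end MatrixTopology

/-! ### Schur complements -/

section Blocks

variable {R : Type*} [Ring R] {ι κ : Type*} [Fintype ι] [DecidableEq ι] [Fintype κ] [DecidableEq κ]

/-- A block matrix with an invertible corner and an invertible Schur complement is invertible. -/
theorem isUnit_of_schurComplement (M : Matrix (ι ⊕ κ) (ι ⊕ κ) R) (u : (Matrix ι ι R)ˣ)
    (hu : (u : Matrix ι ι R) = M.toBlocks₁₁)
    (h : IsUnit (M.toBlocks₂₂ - M.toBlocks₂₁ * (↑u⁻¹ : Matrix ι ι R) * M.toBlocks₁₂)) :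
    IsUnit M := by
  obtain ⟨s, hs⟩ := h
  have h1 : IsUnit (Matrix.fromBlocks (1 : Matrix ι ι R) 0 (M.toBlocks₂₁ * (↑u⁻¹ : Matrix ι ι R)) (1 : Matrix κ κ R)) := by
    refine isUnit_iff_exists.2 ⟨Matrix.fromBlocks 1 0 (-(M.toBlocks₂₁ * (↑u⁻¹ : Matrix ι ι R))) 1, ?_, ?_⟩ <;>
      simp [Matrix.fromBlocks_multiply]
  have h2 : IsUnit (Matrix.fromBlocks (u : Matrix ι ι R) 0 0 (s : Matrix κ κ R)) := by
    refine isUnit_iff_exists.2 ⟨Matrix.fromBlocks (↑u⁻¹ : Matrix ι ι R) 0 0 (↑s⁻¹ : Matrix κ κ R), ?_, ?_⟩ <;>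
      simp [Matrix.fromBlocks_multiply]
  have h3 : IsUnit (Matrix.fromBlocks (1 : Matrix ι ι R) ((↑u⁻¹ : Matrix ι ι R) * M.toBlocks₁₂) 0
      (1 : Matrix κ κ R)) := by
    refine isUnit_iff_exists.2 ⟨Matrix.fromBlocks 1 (-((↑u⁻¹ : Matrix ι ι R) * M.toBlocks₁₂)) 0 1, ?_, ?_⟩ <;>
      simp [Matrix.fromBlocks_multiply]
  have e : M = Matrix.fromBlocks (1 : Matrix ι ι R) 0 (M.toBlocks₂₁ * (↑u⁻¹ : Matrix ι ι R)) 1 *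
      Matrix.fromBlocks (u : Matrix ι ι R) 0 0 (s : Matrix κ κ R) *
      Matrix.fromBlocks 1 ((↑u⁻¹ : Matrix ι ι R) * M.toBlocks₁₂) 0 1 := by
    have e1 : (u : Matrix ι ι R) * ((↑u⁻¹ : Matrix ι ι R) * M.toBlocks₁₂) = M.toBlocks₁₂ := by
      rw [← Matrix.mul_assoc, Units.mul_inv, Matrix.one_mul]
    have e2 : M.toBlocks₂₁ * (↑u⁻¹ : Matrix ι ι R) * (u : Matrix ι ι R) = M.toBlocks₂₁ := by
      rw [Matrix.mul_assoc, Units.inv_mul, Matrix.mul_one]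
    conv_lhs => rw [← Matrix.fromBlocks_toBlocks M]
    simp only [Matrix.fromBlocks_multiply, Matrix.one_mul, Matrix.mul_one, Matrix.zero_mul,
      Matrix.mul_zero, add_zero, zero_add, e1, e2]
    rw [hs, ← hu, ← Matrix.mul_assoc M.toBlocks₂₁, add_sub_cancel]
  rw [e]
  exact (h1.mul h2).mul h3

end Blocks

/-! ### Passing reflection of units to matrices -/

section ReflectUnits

variable {R S : Type*} [Ring R] [NormedRing S] [CompleteSpace S] {ι κ : Type*} [Fintype ι]
  [DecidableEq ι] [Fintype κ] [DecidableEq κ]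

/-- Matrices of size `ι` over `R` whose image under `f` is close to `1` are invertible. -/
def ReflectsUnitsNearOne (f : R →+* S) (ι : Type*) [Fintype ι] [DecidableEq ι] : Prop :=
  ∀ᶠ N in 𝓝 (1 : Matrix ι ι S), ∀ M : Matrix ι ι R, M.map f = N → IsUnit M

/-- For a block matrix near `1`, the upper left corner and the Schur complement are both near `1`.
Once the corner is inverted over `R`, the map `f` carries Schur complement to Schur complement. -/
theorem ReflectsUnitsNearOne.sum {f : R →+* S} (h : ReflectsUnitsNearOne f ι)
    (h' : ReflectsUnitsNearOne f κ) : ReflectsUnitsNearOne f (ι ⊕ κ) := by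
  have c11 : Filter.Tendsto (fun N : Matrix (ι ⊕ κ) (ι ⊕ κ) S => N.toBlocks₁₁) (𝓝 1) (𝓝 1) := by
    have hc : Continuous fun N : Matrix (ι ⊕ κ) (ι ⊕ κ) S => N.toBlocks₁₁ :=
      continuous_id.matrix_submatrix Sum.inl Sum.inl
    convert hc.tendsto 1 using 2
    rw [← Matrix.fromBlocks_one, Matrix.toBlocks_fromBlocks₁₁]
  have cS : Filter.Tendsto (fun N : Matrix (ι ⊕ κ) (ι ⊕ κ) S => N.toBlocks₂₂ -
      N.toBlocks₂₁ * Ring.inverse N.toBlocks₁₁ * N.toBlocks₁₂) (𝓝 1) (𝓝 1) := by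
    have hc22 : Continuous fun N : Matrix (ι ⊕ κ) (ι ⊕ κ) S => N.toBlocks₂₂ :=
      continuous_id.matrix_submatrix Sum.inr Sum.inr
    have hc21 : Continuous fun N : Matrix (ι ⊕ κ) (ι ⊕ κ) S => N.toBlocks₂₁ :=
      continuous_id.matrix_submatrix Sum.inr Sum.inl
    have hc12 : Continuous fun N : Matrix (ι ⊕ κ) (ι ⊕ κ) S => N.toBlocks₁₂ :=
      continuous_id.matrix_submatrix Sum.inl Sum.inr
    have hi := tendsto_ringInverse_one.comp c11
    have hm : Continuous fun q : Matrix κ κ S × Matrix κ ι S × Matrix ι ι S × Matrix ι κ S =>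
        q.1 - q.2.1 * q.2.2.1 * q.2.2.2 :=
      continuous_fst.sub (((continuous_fst.comp continuous_snd).matrix_mul
        (continuous_fst.comp (continuous_snd.comp continuous_snd))).matrix_mul
        (continuous_snd.comp (continuous_snd.comp continuous_snd)))
    have ht := (hm.tendsto _).comp ((hc22.tendsto 1).prodMk_nhds ((hc21.tendsto 1).prodMk_nhds
      (hi.prodMk_nhds (hc12.tendsto 1))))
    have e12 : (1 : Matrix (ι ⊕ κ) (ι ⊕ κ) S).toBlocks₁₂ = 0 := by
      rw [← Matrix.fromBlocks_one, Matrix.toBlocks_fromBlocks₁₂]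
    have e22 : (1 : Matrix (ι ⊕ κ) (ι ⊕ κ) S).toBlocks₂₂ = 1 := by
      rw [← Matrix.fromBlocks_one, Matrix.toBlocks_fromBlocks₂₂]
    simp only [e12, e22, Matrix.mul_zero, sub_zero] at ht
    exact ht
  filter_upwards [c11.eventually h, c11.eventually isUnit_mem_nhds_one, cS.eventually h'] with
    N h1 h2 h3 M hM
  subst hM
  obtain ⟨u, hu⟩ := h1 M.toBlocks₁₁ rfl
  refine isUnit_of_schurComplement M u hu (h3 _ ?_)
  have e : (↑u⁻¹ : Matrix ι ι R).map f = Ring.inverse (M.map f).toBlocks₁₁ := by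
    have : (M.map f).toBlocks₁₁ =
        ((Units.map (f.mapMatrix : Matrix ι ι R →+* Matrix ι ι S).toMonoidHom u :
          (Matrix ι ι S)ˣ) : Matrix ι ι S) := by
      change _ = (u : Matrix ι ι R).map f
      rw [hu]
      rfl
    rw [this, Ring.inverse_unit, ← map_inv]
    rfl
  rw [Matrix.map_sub _ (map_sub f), Matrix.map_mul, Matrix.map_mul, e]
  rfl

theorem ReflectsUnitsNearOne.of_equiv {f : R →+* S} (e : κ ≃ ι) (h : ReflectsUnitsNearOne f κ) :
    ReflectsUnitsNearOne f ι := by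
  have hc : Continuous fun N : Matrix ι ι S => N.submatrix e e :=
    continuous_id.matrix_submatrix e e
  have ht := hc.tendsto 1
  rw [Matrix.submatrix_one_equiv] at ht
  filter_upwards [ht.eventually h] with N hN M hM
  have h1 := hN (M.submatrix e e) (by rw [← Matrix.submatrix_map, hM])
  have h2 := h1.map (Matrix.reindexRingEquiv R e)
  convert h2
  ext i j
  simp

/-- Induction splits off a block of size one, where the claim is that `f` reflects units. Density
plays no role until closeness to `1` is removed. -/
theorem reflectsUnitsNearOne_fin (f : R →+* S) [IsLocalHom f] (n : ℕ) :
    ReflectsUnitsNearOne f (Fin n) := by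
  induction n with
  | zero => exact Filter.Eventually.of_forall fun N M _ => isUnit_of_subsingleton M
  | succ n ih =>
    refine (ReflectsUnitsNearOne.sum ih (κ := Fin 1) ?_).of_equiv finSumFinEquiv
    have hc : Continuous fun N : Matrix (Fin 1) (Fin 1) S => N 0 0 := by fun_prop
    have hu : {x : S | IsUnit x} ∈ 𝓝 ((1 : Matrix (Fin 1) (Fin 1) S) 0 0) := by
      simpa using Units.nhds (1 : Sˣ)
    filter_upwards [hc.tendsto 1 hu] with N hN M hM
    subst hM
    obtain ⟨v, hv⟩ := (isUnit_map_iff f (M 0 0)).1 hN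
    refine ⟨⟨M, Matrix.of fun _ _ => ↑v⁻¹, ?_, ?_⟩, rfl⟩
    · ext i j
      fin_cases i; fin_cases j
      simp [Matrix.mul_apply, ← hv]
    · ext i j
      fin_cases i; fin_cases j
      simp [Matrix.mul_apply, ← hv]

theorem denseRange_matrix_map {m n : Type*} {f : R → S} (hd : DenseRange f) :
    DenseRange fun M : Matrix m n R => M.map f :=
  DenseRange.piMap fun _ => DenseRange.piMap fun _ => hd

theorem isLocalHom_mapMatrix (f : R →+* S) (hd : DenseRange f) [IsLocalHom f] (n : ℕ) :
    IsLocalHom (f.mapMatrix : Matrix (Fin n) (Fin n) R →+* Matrix (Fin n) (Fin n) S) :=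
  isLocalHom_of_nhds_one _ (denseRange_matrix_map hd) (reflectsUnitsNearOne_fin f n)
    fun M hM => hM M rfl

end ReflectUnits

namespace BanachK

/-! ### Criteria for equivalence of idempotent matrices -/

section Idempotents

variable {S : Type*} [NormedRing S] [CompleteSpace S] {ι κ : Type*} [Fintype ι] [DecidableEq ι]
  [Fintype κ] [DecidableEq κ]

/-- The element `u = q p + (1 - q)(1 - p)` intertwines the idempotents, `q u = u p`, and equals `1`
when `q = p`. -/
theorem idemEquiv_of_isUnit {R : Type*} [Ring R] {p q : Matrix ι ι R} (hp : p * p = p)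
    (hq : q * q = q) (h : IsUnit (q * p + (1 - q) * (1 - p))) : IdemEquiv q p := by
  obtain ⟨u, hu⟩ := h
  have e1 : q * (u : Matrix ι ι R) = (u : Matrix ι ι R) * p := by
    rw [hu]
    have h1 : q * (q * p + (1 - q) * (1 - p)) =
        q * q * p + (q - q * q) * (1 - p) := by noncomm_ring
    have h2 : (q * p + (1 - q) * (1 - p)) * p =
        q * (p * p) + (1 - q) * (p - p * p) := by noncomm_ring
    rw [h1, h2, hp, hq, sub_self, sub_self, zero_mul, mul_zero]
  refine ⟨q * (u : Matrix ι ι R), (↑u⁻¹ : Matrix ι ι R) * q, ?_, ?_⟩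
  · rw [mul_assoc, ← mul_assoc (u : Matrix ι ι R), Units.mul_inv, one_mul, hq]
  · rw [mul_assoc, ← mul_assoc q, hq, e1, ← mul_assoc, Units.inv_mul, one_mul]

/-- Nearby idempotents are equivalent. -/
theorem eventually_idemEquiv {p : Matrix ι ι S} (hp : p * p = p) :
    ∀ᶠ q in 𝓝 p, q * q = q → IdemEquiv q p := by
  have hc : Continuous fun q : Matrix ι ι S => q * p + (1 - q) * (1 - p) := by fun_prop
  have ht := hc.tendsto p
  have e : p * p + (1 - p) * (1 - p) = 1 := by
    have : p * p + (1 - p) * (1 - p) = 1 + 2 * (p * p - p) := by noncomm_ring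
    rw [this, hp, sub_self, mul_zero, add_zero]
  rw [e] at ht
  filter_upwards [ht.eventually isUnit_mem_nhds_one] with q hq hqq
  exact idemEquiv_of_isUnit hp hqq hq

/-- The compressions of `x` and `y` need only have products that are invertible in the corners cut
out by `e` and `e'`. Adding the complementary idempotent expresses this by units of full matrix
rings, a condition that is open and reflected by local homomorphisms. -/
theorem idemEquiv_of_isUnit_corners {R : Type*} [Ring R] {e : Matrix ι ι R} {e' : Matrix κ κ R}
    (he : e * e = e) (he' : e' * e' = e') (x : Matrix ι κ R) (y : Matrix κ ι R)
    (h : IsUnit ((e * x * e') * (e' * y * e) + (1 - e)))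
    (h' : IsUnit ((e' * y * e) * (e * x * e') + (1 - e'))) : IdemEquiv e e' := by
  set a := e * x * e' with ha
  set b := e' * y * e with hb
  have hea : e * a = a := by rw [ha, ← Matrix.mul_assoc, ← Matrix.mul_assoc, he]
  have hae : a * e' = a := by rw [ha, Matrix.mul_assoc, he']
  clear_value a b
  obtain ⟨u, hu⟩ := h
  obtain ⟨v, hv⟩ := h'
  have h1 : a * b = e * (u : Matrix ι ι R) := by
    rw [hu, Matrix.mul_add, ← Matrix.mul_assoc, hea, Matrix.mul_sub, he, Matrix.mul_one, sub_self,
      add_zero]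
  have h2 : b * a = (v : Matrix κ κ R) * e' := by
    rw [hv, Matrix.add_mul, Matrix.mul_assoc, hae, Matrix.sub_mul, he', Matrix.one_mul, sub_self,
      add_zero]
  have h3 : a * (b * (↑u⁻¹ : Matrix ι ι R)) = e := by
    rw [← Matrix.mul_assoc, h1, Matrix.mul_assoc, Units.mul_inv, Matrix.mul_one]
  have h4 : (↑v⁻¹ : Matrix κ κ R) * b * a = e' := by
    rw [Matrix.mul_assoc, h2, ← Matrix.mul_assoc, Units.inv_mul, Matrix.one_mul]
  -- The right inverse `b u⁻¹` of `a` relative to `e` is compressed by `e'`, which makes it agree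
  -- with the left inverse coming from `v⁻¹ b`.
  refine ⟨a, e' * (b * (↑u⁻¹ : Matrix ι ι R)), ?_, ?_⟩
  · rw [← Matrix.mul_assoc, hae, h3]
  · calc e' * (b * (↑u⁻¹ : Matrix ι ι R)) * a
        = (↑v⁻¹ : Matrix κ κ R) * b * (a * (b * (↑u⁻¹ : Matrix ι ι R))) * a := by
          rw [← h4]; simp only [Matrix.mul_assoc]
      _ = e' := by rw [h3, Matrix.mul_assoc, hea, h4]

end Idempotents

/-! ### The density theorem for the K-theory of unital Banach algebras -/

section Density

variable {R S : Type*} [NormedRing R] [NormedAlgebra ℂ R] [CompleteSpace R]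
  [NormedRing S] [NormedAlgebra ℂ S] [CompleteSpace S]

theorem exists_idemMatrix_map_equiv (f : R →ₐ[ℂ] S) (hf : Continuous f) (hd : DenseRange f)
    [IsLocalHom f] {n : ℕ} {p : Matrix (Fin n) (Fin n) S} (hp : p * p = p) :
    ∃ e : Matrix (Fin n) (Fin n) R, e * e = e ∧ IdemEquiv (e.map f) p := by
  have : IsLocalHom (f : R →+* S) := ⟨fun a ha => IsLocalHom.map_nonunit (f := f) a ha⟩
  have hloc : IsLocalHom (f.mapMatrix : Matrix (Fin n) (Fin n) R →ₐ[ℂ] Matrix (Fin n) (Fin n) S) :=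
    ⟨fun a ha => (isLocalHom_mapMatrix (f : R →+* S) hd n).map_nonunit a ha⟩
  have hcont : Continuous (f.mapMatrix : Matrix (Fin n) (Fin n) R →ₐ[ℂ] _) :=
    continuous_id.matrix_map hf
  have key : ∃ e : Matrix (Fin n) (Fin n) R, e * e = e ∧
      f.mapMatrix e ∈ {q | q * q = q → IdemEquiv q p} :=
    @exists_idem_map_mem (Matrix (Fin n) (Fin n) R) (Matrix (Fin n) (Fin n) S)
      Matrix.linftyOpNormedRing Matrix.linftyOpNormedRing Matrix.linftyOpNormedAlgebra
      Matrix.linftyOpNormedAlgebra completeSpace_linftyOp completeSpace_linftyOp f.mapMatrix hcont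
      (denseRange_matrix_map hd) hloc p hp _ (eventually_idemEquiv hp)
  obtain ⟨e, he, h⟩ := key
  exact ⟨e, he, h (by rw [← map_mul, he])⟩

/-- The matrices `x`, `y` over `S` are approximated by images of matrices over `R`. After
compression, the corner expressions are near `1`, hence units over `S`, hence units over `R`; an
exact lift of the equivalence is not needed. -/
theorem idemEquiv_of_map (f : R →+* S) (hd : DenseRange f) [IsLocalHom f]
    {n m : ℕ} {e : Matrix (Fin n) (Fin n) R} {e' : Matrix (Fin m) (Fin m) R} (he : e * e = e)
    (he' : e' * e' = e') (h : IdemEquiv (e.map f) (e'.map f)) : IdemEquiv e e' := by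
  obtain ⟨x, y, h1, h2⟩ := h
  set E := e.map f with hE
  set E' := e'.map f with hE'
  have hEE : E * E = E := by rw [hE, ← Matrix.map_mul, he]
  have hEE' : E' * E' = E' := by rw [hE', ← Matrix.map_mul, he']
  have c1 : Continuous fun q : Matrix (Fin n) (Fin m) S × Matrix (Fin m) (Fin n) S =>
      (E * q.1 * E') * (E' * q.2 * E) + (1 - E) := by fun_prop
  have c2 : Continuous fun q : Matrix (Fin n) (Fin m) S × Matrix (Fin m) (Fin n) S =>
      (E' * q.2 * E) * (E * q.1 * E') + (1 - E') := by fun_prop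
  have v1 : (E * x * E') * (E' * y * E) + (1 - E) = 1 := by
    have : (E * x * E') * (E' * y * E) = E := by
      calc (E * x * E') * (E' * y * E) = E * x * (E' * E') * y * E := by
            simp only [Matrix.mul_assoc]
        _ = E * (x * y) * (x * y) * E := by rw [hEE', ← h2]; simp only [Matrix.mul_assoc]
        _ = E := by rw [h1, hEE, hEE, hEE]
    rw [this, add_sub_cancel]
  have v2 : (E' * y * E) * (E * x * E') + (1 - E') = 1 := by
    have : (E' * y * E) * (E * x * E') = E' := by
      calc (E' * y * E) * (E * x * E') = E' * y * (E * E) * x * E' := by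
            simp only [Matrix.mul_assoc]
        _ = E' * (y * x) * (y * x) * E' := by rw [hEE, ← h1]; simp only [Matrix.mul_assoc]
        _ = E' := by rw [h2, hEE', hEE', hEE']
    rw [this, add_sub_cancel]
  have t1 := c1.tendsto (x, y)
  have t2 := c2.tendsto (x, y)
  simp only [v1] at t1
  simp only [v2] at t2
  have hev := (t1.eventually isUnit_mem_nhds_one).and (t2.eventually isUnit_mem_nhds_one)
  have hdd := (denseRange_matrix_map (m := Fin n) (n := Fin m) hd).prodMap
    (denseRange_matrix_map (m := Fin m) (n := Fin n) hd)
  obtain ⟨_, ⟨hu, hv⟩, ⟨x₀, y₀⟩, rfl⟩ := mem_closure_iff_nhds.1 (hdd (x, y)) _ hev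
  refine idemEquiv_of_isUnit_corners he he' x₀ y₀ ?_ ?_
  · refine (isLocalHom_mapMatrix f hd n).map_nonunit _ ?_
    simpa [RingHom.mapMatrix_apply, Matrix.map_add, Matrix.map_sub, Matrix.map_mul] using hu
  · refine (isLocalHom_mapMatrix f hd m).map_nonunit _ ?_
    simpa [RingHom.mapMatrix_apply, Matrix.map_add, Matrix.map_sub, Matrix.map_mul] using hv

theorem IdemClass.map_bijective (f : R →ₐ[ℂ] S) (hf : Continuous f) (hd : DenseRange f)
    [IsLocalHom f] : Function.Bijective (IdemClass.map (f : R →+* S)) := by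
  have : IsLocalHom (f : R →+* S) := ⟨fun a ha => IsLocalHom.map_nonunit (f := f) a ha⟩
  constructor
  · rintro ⟨e⟩ ⟨e'⟩ h
    exact Quotient.sound (idemEquiv_of_map (f : R →+* S) hd e.idem e'.idem (Quotient.exact h))
  · rintro ⟨p⟩
    obtain ⟨e, he, h⟩ := exists_idemMatrix_map_equiv f hf hd p.idem
    exact ⟨Quotient.mk _ ⟨p.size, e, he⟩, Quotient.sound h⟩

theorem K0Unital.map_bijective_of_idemClass {R S : Type*} [Ring R] [Ring S] (f : R →+* S)
    (h : Function.Bijective (IdemClass.map f)) : Function.Bijective (K0Unital.map f) := by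
  let g := AddEquiv.ofBijective (IdemClass.map f) h
  let G : K0Unital S →+ K0Unital R :=
    Algebra.GrothendieckAddGroup.lift (Algebra.GrothendieckAddGroup.of.comp g.symm.toAddMonoidHom)
  have hG : ∀ x, G (Algebra.GrothendieckAddGroup.of x) =
      Algebra.GrothendieckAddGroup.of (g.symm x) := fun x =>
    DFunLike.congr_fun (Algebra.GrothendieckAddGroup.lift.symm_apply_apply
      (Algebra.GrothendieckAddGroup.of.comp g.symm.toAddMonoidHom)) x
  have h1 : G.comp (K0Unital.map f) = AddMonoidHom.id _ := by
    apply Algebra.GrothendieckAddGroup.lift.symm.injective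
    ext x
    simp only [Algebra.GrothendieckAddGroup.lift_symm_apply, AddMonoidHom.comp_apply,
      K0Unital.map_of, hG, AddMonoidHom.id_apply]
    exact congrArg _ (g.symm_apply_apply x)
  have h2 : (K0Unital.map f).comp G = AddMonoidHom.id _ := by
    apply Algebra.GrothendieckAddGroup.lift.symm.injective
    ext x
    simp only [Algebra.GrothendieckAddGroup.lift_symm_apply, AddMonoidHom.comp_apply,
      K0Unital.map_of, hG, AddMonoidHom.id_apply]
    exact congrArg _ (g.apply_symm_apply x)
  exact Function.bijective_iff_has_inverse.2
    ⟨G, fun x => DFunLike.congr_fun h1 x, fun x => DFunLike.congr_fun h2 x⟩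

theorem Pi0GL.map_bijective (f : R →ₐ[ℂ] S) (hf : Continuous f) (hd : DenseRange f)
    [IsLocalHom f] (n : ℕ) : Function.Bijective (Pi0GL.map (f : R →+* S) hf n) := by
  have : IsLocalHom (f : R →+* S) := ⟨fun a ha => IsLocalHom.map_nonunit (f := f) a ha⟩
  have hloc : IsLocalHom (f.mapMatrix : Matrix (Fin n) (Fin n) R →ₐ[ℂ] Matrix (Fin n) (Fin n) S) :=
    ⟨fun a ha => (isLocalHom_mapMatrix (f : R →+* S) hd n).map_nonunit a ha⟩
  have hd' : DenseRange (f.mapMatrix : Matrix (Fin n) (Fin n) R →ₐ[ℂ] Matrix (Fin n) (Fin n) S) :=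
    denseRange_matrix_map hd
  let F : GLn R n →* GLn S n :=
    Units.map ((f : R →+* S).mapMatrix : Matrix (Fin n) (Fin n) R →+* _).toMonoidHom
  have hinj : ∀ u : GLn R n, F u ∈ Subgroup.connectedComponentOfOne (GLn S n) →
      u ∈ Subgroup.connectedComponentOfOne (GLn R n) :=
    @mem_connectedComponent_of_map_mem (Matrix (Fin n) (Fin n) R) (Matrix (Fin n) (Fin n) S)
      Matrix.linftyOpNormedRing Matrix.linftyOpNormedRing Matrix.linftyOpNormedAlgebra
      Matrix.linftyOpNormedAlgebra completeSpace_linftyOp completeSpace_linftyOp f.mapMatrix hd' hloc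
  have hsurj : ∀ v : GLn S n, ∃ u : GLn R n,
      v⁻¹ * F u ∈ Subgroup.connectedComponentOfOne (GLn S n) :=
    @exists_inv_mul_map_mem_connectedComponent (Matrix (Fin n) (Fin n) R) (Matrix (Fin n) (Fin n) S)
      Matrix.linftyOpNormedRing Matrix.linftyOpNormedRing Matrix.linftyOpNormedAlgebra
      Matrix.linftyOpNormedAlgebra completeSpace_linftyOp completeSpace_linftyOp f.mapMatrix hd' hloc
  constructor
  · refine (injective_iff_map_eq_one _).2 fun x hx => ?_
    induction x using QuotientGroup.induction_on with | _ u => ?_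
    exact (QuotientGroup.eq_one_iff u).2 (hinj u ((QuotientGroup.eq_one_iff (F u)).1 hx))
  · intro y
    induction y using QuotientGroup.induction_on with | _ v => ?_
    obtain ⟨u, hu⟩ := hsurj v
    exact ⟨(u : Pi0GL R n), (QuotientGroup.eq.2 hu).symm⟩

theorem K1Unital.map_bijective_of_pi0 {R S : Type*} [NormedRing R] [NormedRing S] (f : R →+* S)
    (hf : Continuous f) (h : ∀ n, Function.Bijective (Pi0GL.map f hf n)) :
    Function.Bijective (K1Unital.map f hf) := by
  constructor
  · refine (injective_iff_map_eq_one _).2 fun x hx => ?_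
    induction x using DirectLimit.induction with | _ n x => ?_
    obtain ⟨m, hm, hx⟩ := (DirectLimit.exists_eq_one (f := stabPi0 S) ⟨n, Pi0GL.map f hf n x⟩).1 hx
    refine (DirectLimit.exists_eq_one (f := stabPi0 R) ⟨n, x⟩).2 ⟨m, hm, ?_⟩
    refine (injective_iff_map_eq_one _).1 (h m).1 _ ?_
    rw [← hx]
    induction x using QuotientGroup.induction_on with | _ u => ?_
    refine congrArg _ (Units.ext ?_)
    ext i j
    simp [stabHom, stabMatrix]
    split_ifs <;> simp
  · intro y
    induction y using DirectLimit.induction with | _ n y => ?_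
    obtain ⟨x, rfl⟩ := (h n).2 y
    exact ⟨⟦⟨n, x⟩⟧, rfl⟩

end Density

/-! ### Full homomorphisms and unitalisations -/

section NonUnital

variable {A B C : Type*} [NonUnitalNormedRing A] [NormedSpace ℂ A] [IsScalarTower ℂ A A]
  [SMulCommClass ℂ A A] [NonUnitalNormedRing B] [NormedSpace ℂ B] [IsScalarTower ℂ B B]
  [SMulCommClass ℂ B B] [NonUnitalNormedRing C] [NormedSpace ℂ C] [IsScalarTower ℂ C C]
  [SMulCommClass ℂ C C]

theorem plusMap_comp (ψ : B →ₙₐ[ℂ] C) (φ : A →ₙₐ[ℂ] B) :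
    plusMap (ψ.comp φ) = (plusMap ψ).comp (plusMap φ) := by
  ext x
  rw [RingHom.comp_apply, plusMap_apply, plusMap_apply, plusMap_apply]
  simp

/-- `φ⁺` as a homomorphism of `ℂ`-algebras. -/
noncomputable def plusAlgHom (φ : A →ₙₐ[ℂ] B) : Plus A →ₐ[ℂ] Plus B :=
  (WithLp.unitizationAlgEquiv (𝕜 := ℂ) (A := B) ℂ).symm.toAlgHom.comp
    ((Unitization.lift ((Unitization.inrNonUnitalAlgHom ℂ B).comp φ)).comp
      (WithLp.unitizationAlgEquiv (𝕜 := ℂ) (A := A) ℂ).toAlgHom)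

theorem denseRange_plusMap (φ : A →ₙₐ[ℂ] B) (hd : DenseRange φ) : DenseRange (plusMap φ) := by
  refine Metric.dense_iff.2 fun y ε hε => ?_
  obtain ⟨a, ha⟩ := hd.exists_dist_lt (WithLp.ofLp y).snd hε
  refine ⟨_, ?_, WithLp.toLp 1 (Unitization.inl (WithLp.ofLp y).fst + Unitization.inr a), rfl⟩
  rw [Metric.mem_ball, dist_comm, dist_eq_norm, WithLp.unitization_norm_def, plusMap_apply]
  rw [dist_eq_norm] at ha
  simpa [sub_eq_add_neg] using ha

/-- Writing `x = z + a`, the hypothesis reads `|z - 1| + ‖φ a‖ < 1`, which forces `‖φ a‖ < |z|`. As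
`φ` preserves the spectral radius, that of `-a` is below `|z|`, so `z + a` is invertible. -/
theorem isUnit_of_norm_plusMap_sub_one_lt [CompleteSpace B] {φ : A →ₙₐ[ℂ] B}
    (h : ∀ a, banachSpectralRadius (φ a) = banachSpectralRadius a) {x : Plus A}
    (hx : ‖plusMap φ x - 1‖ < 1) : IsUnit x := by
  set z := (WithLp.ofLp x).fst with hz
  set a := (WithLp.ofLp x).snd with ha
  have hxe : WithLp.ofLp x = Unitization.inl z + Unitization.inr a :=
    (Unitization.inl_fst_add_inr_snd_eq _).symm
  have hn : ‖z - 1‖ + ‖φ a‖ < 1 := by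
    rw [WithLp.unitization_norm_def, plusMap_apply] at hx
    have e1 : (WithLp.ofLp (1 : Plus B)).fst = 1 := rfl
    have e2 : (WithLp.ofLp (1 : Plus B)).snd = 0 := rfl
    simpa [sub_eq_add_neg, e1, e2] using hx
  have hlt : ‖φ a‖ < ‖z‖ := by
    have : ‖(1 : ℂ)‖ ≤ ‖z‖ + ‖z - 1‖ := by
      calc ‖(1 : ℂ)‖ = ‖z - (z - 1)‖ := by rw [sub_sub_cancel]
        _ ≤ _ := norm_sub_le _ _
    rw [norm_one] at this
    linarith
  have hz0 : z ≠ 0 := norm_pos_iff.1 ((norm_nonneg _).trans_lt hlt)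
  have hr : banachSpectralRadius (-a) < ‖((Units.mk0 z hz0 : ℂˣ) : ℂ)‖₊ := by
    rw [← h, map_neg]
    refine (banachSpectralRadius_le_norm _).trans_lt ?_
    rw [nnnorm_neg]
    exact_mod_cast hlt
  have hq := isQuasiregular_of_radius_lt hr
  rw [smul_neg, neg_neg, isQuasiregular_iff_isUnit' ℂ] at hq
  have hu : IsUnit (Unitization.inl z : Unitization ℂ A) :=
    (isUnit_iff_ne_zero.2 hz0).map (Unitization.inlRingHom ℂ A)
  have hm := hu.mul hq
  have e : (Unitization.inl z : Unitization ℂ A) *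
      (1 + (((Units.mk0 z hz0)⁻¹ • a : A) : Unitization ℂ A)) = WithLp.ofLp x := by
    rw [hxe, mul_add, mul_one, Unitization.inl_mul_inr, Units.smul_def, smul_smul]
    simp [hz0]
  rw [e] at hm
  exact hm.map (WithLp.unitizationAlgEquiv (𝕜 := ℂ) (A := A) ℂ).symm

theorem isLocalHom_plusMap [CompleteSpace B] {φ : A →ₙₐ[ℂ] B} (h : IsFull φ) :
    IsLocalHom (plusMap φ) :=
  isLocalHom_of_nhds_one _ (denseRange_plusMap φ h.denseRange) (Metric.ball_mem_nhds 1 one_pos)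
    fun x hx => isUnit_of_norm_plusMap_sub_one_lt h.radius_map (by simpa [dist_eq_norm] using hx)

/-- Full homomorphisms induce isomorphisms on the K-theory of the unitalisations. -/
theorem plusMap_bijective_of_isFull [CompleteSpace A] [CompleteSpace B] {φ : A →ₙₐ[ℂ] B}
    (h : IsFull φ) (hφ : Continuous φ) :
    Function.Bijective (K0Unital.map (plusMap φ)) ∧
      Function.Bijective (K1Unital.map (plusMap φ) (continuous_plusMap φ hφ)) := by
  have : IsLocalHom (plusAlgHom φ) :=
    ⟨fun a ha => (isLocalHom_plusMap h).map_nonunit a ha⟩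
  have hd : DenseRange (plusAlgHom φ) := denseRange_plusMap φ h.denseRange
  have hc : Continuous (plusAlgHom φ) := continuous_plusMap φ hφ
  exact ⟨K0Unital.map_bijective_of_idemClass _ (IdemClass.map_bijective (plusAlgHom φ) hc hd),
    K1Unital.map_bijective_of_pi0 _ _ (Pi0GL.map_bijective (plusAlgHom φ) hc hd)⟩

/-- The unitalised map is compatible with the augmentations, so a preimage of a class in the kernel
again lies in the kernel. -/
theorem K0.map_bijective (φ : A →ₙₐ[ℂ] B) (h : Function.Bijective (K0Unital.map (plusMap φ))) :
    Function.Bijective (K0.map φ) := by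
  constructor
  · intro x y hxy
    exact Subtype.ext (h.1 (congrArg Subtype.val hxy))
  · rintro ⟨y, hy⟩
    obtain ⟨x, rfl⟩ := h.2 y
    refine ⟨⟨x, ?_⟩, rfl⟩
    change K0Unital.map (augmentation B) (K0Unital.map (plusMap φ) x) = 0 at hy
    rw [K0Unital.map_map, augmentation_comp_plusMap] at hy
    exact hy

theorem K1.map_bijective (φ : A →ₙₐ[ℂ] B) (hφ : Continuous φ)
    (h : Function.Bijective (K1Unital.map (plusMap φ) (continuous_plusMap φ hφ))) :
    Function.Bijective (K1.map φ hφ) := by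
  constructor
  · intro x y hxy
    exact Subtype.ext (h.1 (congrArg Subtype.val hxy))
  · rintro ⟨y, hy⟩
    obtain ⟨x, rfl⟩ := h.2 y
    refine ⟨⟨x, ?_⟩, rfl⟩
    change K1Unital.map (augmentation B) (continuous_augmentation B)
      (K1Unital.map (plusMap φ) (continuous_plusMap φ hφ) x) = 1 at hy
    rw [K1Unital.map_map] at hy
    simp only [augmentation_comp_plusMap] at hy
    exact hy

/-- The two-out-of-three property: if `ψ` and `ψ ∘ φ` induce isomorphisms, so does `φ`. -/
theorem plusMap_bijective_of_comp {φ : A →ₙₐ[ℂ] B} {ψ : B →ₙₐ[ℂ] C} (hφ : Continuous φ)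
    (hψ : Continuous ψ) (hψφ : Continuous (ψ.comp φ))
    (h : Function.Bijective (K0Unital.map (plusMap ψ)) ∧
      Function.Bijective (K1Unital.map (plusMap ψ) (continuous_plusMap ψ hψ)))
    (h' : Function.Bijective (K0Unital.map (plusMap (ψ.comp φ))) ∧
      Function.Bijective (K1Unital.map (plusMap (ψ.comp φ)) (continuous_plusMap _ hψφ))) :
    Function.Bijective (K0Unital.map (plusMap φ)) ∧
      Function.Bijective (K1Unital.map (plusMap φ) (continuous_plusMap φ hφ)) := by
  constructor
  · rw [← Function.Bijective.of_comp_iff' h.1]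
    convert h'.1 using 1
    funext x
    rw [Function.comp_apply, K0Unital.map_map, plusMap_comp]
  · rw [← Function.Bijective.of_comp_iff' h.2]
    convert h'.2 using 1
    funext x
    rw [Function.comp_apply, K1Unital.map_map]
    simp only [plusMap_comp]

end NonUnital

end BanachK

theorem mainTheorem7 {X : Type*} [TopologicalSpace X] [LocallyCompactSpace X] [T2Space X] :
    (SecondCountableTopology X →
      ∀ (A A' : Type*)
        [NonUnitalNormedRing A] [NormedSpace ℂ A] [IsScalarTower ℂ A A] [SMulCommClass ℂ A A]
        [CompleteSpace A] [C0BanachAlgebra X A]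
        [NonUnitalNormedRing A'] [NormedSpace ℂ A'] [IsScalarTower ℂ A' A']
        [SMulCommClass ℂ A' A'] [CompleteSpace A'] [C0BanachAlgebra X A']
        (φ : C0BanachAlgebra.ContractiveHom X A A'),
        (∀ x : X, IsIsoradial (φ.fibreMap x)) →
          IsIsoradial φ.toNonUnitalAlgHom ∧
          ((∀ x : X, DenseRange (φ.fibreMap x)) →
            Function.Bijective (BanachK.K0.map φ.toNonUnitalAlgHom) ∧
            Function.Bijective (BanachK.K1.map φ.toNonUnitalAlgHom φ.continuous))) ∧
    (∀ (A : Type*)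
        [NonUnitalNormedRing A] [NormedSpace ℂ A] [IsScalarTower ℂ A A] [SMulCommClass ℂ A A]
        [CompleteSpace A] [C0BanachAlgebra X A],
        IsFull (C0BanachAlgebra.gelfandHom X A).toNonUnitalAlgHom ∧
        Function.Bijective (BanachK.K0.map (C0BanachAlgebra.gelfandHom X A).toNonUnitalAlgHom) ∧
        Function.Bijective (BanachK.K1.map (C0BanachAlgebra.gelfandHom X A).toNonUnitalAlgHom
          (C0BanachAlgebra.gelfandHom X A).continuous)) := by
  refine ⟨fun _ A A' _ _ _ _ _ _ _ _ _ _ _ _ φ hφ => ?_, fun A _ _ _ _ _ _ => ?_⟩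
  · have hiso := C0BanachAlgebra.isIsoradial_of_fibre φ hφ
    refine ⟨hiso, fun hd => ?_⟩
    have hι : IsFull (C0BanachAlgebra.gelfandHom X A').toNonUnitalAlgHom :=
      C0BanachAlgebra.isFull_gelfandHom X A'
    -- Fibrewise density makes the image of `A` dense in the Gelfand transform of `A'`, whose norm
    -- is the supremum of the fibre norms; the composite is therefore full.
    have hcomp : IsFull ((C0BanachAlgebra.gelfandHom X A').toNonUnitalAlgHom.comp
        φ.toNonUnitalAlgHom) :=
      { norm_map_le := fun a => (hι.norm_map_le _).trans (hiso.norm_map_le a)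
        radius_map := fun a => (hι.radius_map _).trans (hiso.radius_map a)
        denseRange := C0BanachAlgebra.denseRange_gelfandHom_comp φ hd }
    have hcont : Continuous ((C0BanachAlgebra.gelfandHom X A').toNonUnitalAlgHom.comp
        φ.toNonUnitalAlgHom) := (C0BanachAlgebra.gelfandHom X A').continuous.comp φ.continuous
    have h := BanachK.plusMap_bijective_of_comp φ.continuous
      (C0BanachAlgebra.gelfandHom X A').continuous hcont
      (BanachK.plusMap_bijective_of_isFull hι (C0BanachAlgebra.gelfandHom X A').continuous)
      (BanachK.plusMap_bijective_of_isFull hcomp hcont)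
    exact ⟨BanachK.K0.map_bijective _ h.1, BanachK.K1.map_bijective _ _ h.2⟩
  · have hι := C0BanachAlgebra.isFull_gelfandHom X A
    have h := BanachK.plusMap_bijective_of_isFull hι (C0BanachAlgebra.gelfandHom X A).continuous
    exact ⟨hι, BanachK.K0.map_bijective _ h.1, BanachK.K1.map_bijective _ _ h.2⟩
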